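/- Let $\mathbb O$ be the real algebra of octonions, with orthonormal basis $e_0=1,e_1,\dots,e_7$, where $e_i^2=-1$ for $i\ge1$, distinct imaginary units anticommute, and $e_ie_{i+1}=e_{i+3}$, $e_{i+1}e_{i+3}=e_i$, $e_{i+3}e_i=e_{i+1}$ (indices $1,\dots,7$ modulo $7$). Let $\mathfrak h_3(\mathbb O)$ be the real vector space of Hermitian $3\times3$ octonionic matrices, with $$\det\begin{pmatrix}\alpha&\bar z&\bar y\\ z&\beta&x\\ y&\bar x&\gamma\end{pmatrix}=\alpha\beta\gamma-\alpha|x|^2-\beta|y|^2-\gamma|z|^2+2\operatorname{Re}\big((xy)\bar z\big).$$ Call $M\in\mathfrak h_3(\mathbb O)$ positive definite if all its eigenvalues, i.e. the roots of $t\mapsto\det(tI-M)$ (which are real), are positive. Let $G=\mathrm{SL}_3(\mathbb O)=E_{6(-26)}$ be the Lie group of real linear automorphisms of $\mathfrak h_3(\mathbb O)$ preserving $\det$, let $K=\mathrm{SU}_3(\mathbb O)$ be the stabilizer of the identity matrix $I$ in $G$, and let $X=G/K$ be the symmetric space of $G$. Let $\mathcal O\subset\mathbb O$ be an order containing $\mathbb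 Z[e_0,\dots,e_7]$, i.e. an additive subgroup generated by a real basis of $\mathbb O$, stable under multiplication and containing $e_0,\dots,e_7$. Call (normalized) marked lattice any map $f:\mathcal O^3\to\mathbb O^3$ of the form $f(u)=k(Mu)$, where $M\in\mathfrak h_3(\mathbb O)$ is positive definite with $\det M=1$ and $k$ is a linear isometry of the Euclidean space $\mathbb O^3=\mathbb R^{24}$. Two marked lattices $f,f'$ are isometric if $f'=k\circ f$ for some linear isometry $k$ of $\mathbb O^3$. The set $\mathcal E$ of isometry classes $[f]$ carries the quotient of the topology of pointwise convergence. For a set $E$, let $\mathbb P(\mathbb R_+^E)$ be the quotient of $\mathbb R_+^E\setminus\{0\}$ (product topology) by positive homotheties, and let $\phi:\mathcal E\to\mathbb P(\mathbb R_+^{\mathcal O^3})$ be the length function map $[f]\mapsto[u\mapsto\|f(u)\|]$. A $G$-compactification of $X$ is a pair $(C,i)$, where $C$ is a compact Hausdorff space and $i:X\to C$ is a topological embedding with dense image, such that the action of $G$ on $X$ extends (necessarily uniquely) to a continuous action of $G$ on $C$. Two of them, $(C,i)$ and $(C',i')$, are $G$-isomorphic if there is a $G$-equivariant homeomorphism $F:C\to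 C'$ with $i'=F\circ i$. **Theorem.** (1) The map $gK\mapsto g\cdot I$ is a homeomorphism from $X$ onto the space of positive definite matrices of determinant $1$ in $\mathfrak h_3(\mathbb O)$. There is a homeomorphism $m:X\to\mathcal E$ such that, for $x=gK\in X$ and $M$ positive definite of determinant $1$, $m(x)$ is the class of the marked lattice $u\mapsto Mu$ if and only if $g\cdot I=MM=MM^*$. (2) The closure $\overline X^{\mathcal T}$ of the image of $\phi\circ m:X\to\mathbb P(\mathbb R_+^{\mathcal O^3})$, together with $\phi\circ m$, is a $G$-compactification of $X$ (the Thurston compactification). (3) The closure $\overline X^{\mathcal S}$ of the image of $X\to\mathbb P(\mathfrak h_3(\mathbb O))$, $gK\mapsto\mathbb R(g\cdot I)$, together with this map, is a $G$-compactification of $X$ (the Satake compactification). (4) The $G$-compactifications $\overline X^{\mathcal T}$ and $\overline X^{\mathcal S}$ are $G$-isomorphic. -/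

import Mathlib

open Topology
open scoped NNReal

noncomputable section

namespace OctonionicSatake

/-! ### The octonions -/

/-- The octonions, with the Euclidean structure making `e₀ = 1, e₁, …, e₇` orthonormal. -/
def Octonion : Type := EuclideanSpace ℝ (Fin 8)

namespace Octonion

instance : NormedAddCommGroup Octonion := inferInstanceAs (NormedAddCommGroup (EuclideanSpace ℝ (Fin 8)))

instance : InnerProductSpace ℝ Octonion := inferInstanceAs (InnerProductSpace ℝ (EuclideanSpace ℝ (Fin 8)))

instance : FiniteDimensional ℝ Octonion := inferInstanceAs (FiniteDimensional ℝ (EuclideanSpace ℝ (Fin 8)))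

/-- The octonion with given coordinates. -/
def mk (v : Fin 8 → ℝ) : Octonion := WithLp.toLp 2 v

/-- The `i`-th coordinate. -/
def coord (x : Octonion) (i : Fin 8) : ℝ := WithLp.ofLp x i

@[ext] theorem ext {x y : Octonion} (h : ∀ i, x.coord i = y.coord i) : x = y :=
  PiLp.ext h

@[simp] theorem coord_mk (v : Fin 8 → ℝ) (i : Fin 8) : (mk v).coord i = v i := rfl
@[simp] theorem coord_zero (i : Fin 8) : (0 : Octonion).coord i = 0 := rfl
@[simp] theorem coord_add (x y : Octonion) (i : Fin 8) : (x + y).coord i = x.coord i + y.coord i := rfl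
@[simp] theorem coord_smul (r : ℝ) (x : Octonion) (i : Fin 8) : (r • x).coord i = r * x.coord i := rfl

/-- The basis vector `eᵢ`. -/
def e (i : Fin 8) : Octonion := mk (Pi.single i 1)

/-- The Cayley product: `e₀ = 1`, `eᵢ² = -1` for `i ≥ 1`, distinct imaginary units anticommute and,
with indices `1, …, 7` read modulo 7, `eᵢ eᵢ₊₁ = eᵢ₊₃` together with its cyclic permutations. -/
instance : Mul Octonion where
  mul a b :=
    let x := a.coord
    let y := b.coord
    mk ![
      x 0 * y 0 - x 1 * y 1 - x 2 * y 2 - x 3 * y 3 - x 4 * y 4 - x 5 * y 5 - x 6 * y 6 - x 7 * y 7,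
      x 0 * y 1 + x 1 * y 0 + x 2 * y 4 + x 3 * y 7 - x 4 * y 2 + x 5 * y 6 - x 6 * y 5 - x 7 * y 3,
      x 0 * y 2 - x 1 * y 4 + x 2 * y 0 + x 3 * y 5 + x 4 * y 1 - x 5 * y 3 + x 6 * y 7 - x 7 * y 6,
      x 0 * y 3 - x 1 * y 7 - x 2 * y 5 + x 3 * y 0 + x 4 * y 6 + x 5 * y 2 - x 6 * y 4 + x 7 * y 1,
      x 0 * y 4 + x 1 * y 2 - x 2 * y 1 - x 3 * y 6 + x 4 * y 0 + x 5 * y 7 + x 6 * y 3 - x 7 * y 5,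
      x 0 * y 5 - x 1 * y 6 + x 2 * y 3 - x 3 * y 2 - x 4 * y 7 + x 5 * y 0 + x 6 * y 1 + x 7 * y 4,
      x 0 * y 6 + x 1 * y 5 - x 2 * y 7 + x 3 * y 4 - x 4 * y 3 - x 5 * y 1 + x 6 * y 0 + x 7 * y 2,
      x 0 * y 7 + x 1 * y 3 + x 2 * y 6 - x 3 * y 1 + x 4 * y 5 - x 5 * y 4 - x 6 * y 2 + x 7 * y 0]

instance : One Octonion := ⟨e 0⟩

/-- Octonionic conjugation. -/
instance : Star Octonion where
  star x := mk fun i => if i = 0 then x.coord i else - x.coord i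

/-- The real part, as a real number. -/
def re (x : Octonion) : ℝ := x.coord 0

theorem coord_mul (a b : Octonion) (i : Fin 8) : (a * b).coord i =
    (![
      a.coord 0 * b.coord 0 - a.coord 1 * b.coord 1 - a.coord 2 * b.coord 2 - a.coord 3 * b.coord 3
        - a.coord 4 * b.coord 4 - a.coord 5 * b.coord 5 - a.coord 6 * b.coord 6 - a.coord 7 * b.coord 7,
      a.coord 0 * b.coord 1 + a.coord 1 * b.coord 0 + a.coord 2 * b.coord 4 + a.coord 3 * b.coord 7
        - a.coord 4 * b.coord 2 + a.coord 5 * b.coord 6 - a.coord 6 * b.coord 5 - a.coord 7 * b.coord 3,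
      a.coord 0 * b.coord 2 - a.coord 1 * b.coord 4 + a.coord 2 * b.coord 0 + a.coord 3 * b.coord 5
        + a.coord 4 * b.coord 1 - a.coord 5 * b.coord 3 + a.coord 6 * b.coord 7 - a.coord 7 * b.coord 6,
      a.coord 0 * b.coord 3 - a.coord 1 * b.coord 7 - a.coord 2 * b.coord 5 + a.coord 3 * b.coord 0
        + a.coord 4 * b.coord 6 + a.coord 5 * b.coord 2 - a.coord 6 * b.coord 4 + a.coord 7 * b.coord 1,
      a.coord 0 * b.coord 4 + a.coord 1 * b.coord 2 - a.coord 2 * b.coord 1 - a.coord 3 * b.coord 6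
        + a.coord 4 * b.coord 0 + a.coord 5 * b.coord 7 + a.coord 6 * b.coord 3 - a.coord 7 * b.coord 5,
      a.coord 0 * b.coord 5 - a.coord 1 * b.coord 6 + a.coord 2 * b.coord 3 - a.coord 3 * b.coord 2
        - a.coord 4 * b.coord 7 + a.coord 5 * b.coord 0 + a.coord 6 * b.coord 1 + a.coord 7 * b.coord 4,
      a.coord 0 * b.coord 6 + a.coord 1 * b.coord 5 - a.coord 2 * b.coord 7 + a.coord 3 * b.coord 4
        - a.coord 4 * b.coord 3 - a.coord 5 * b.coord 1 + a.coord 6 * b.coord 0 + a.coord 7 * b.coord 2,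
      a.coord 0 * b.coord 7 + a.coord 1 * b.coord 3 + a.coord 2 * b.coord 6 - a.coord 3 * b.coord 1
        + a.coord 4 * b.coord 5 - a.coord 5 * b.coord 4 - a.coord 6 * b.coord 2 + a.coord 7 * b.coord 0]
      : Fin 8 → ℝ) i := rfl

theorem coord_one (i : Fin 8) : (1 : Octonion).coord i = if i = 0 then 1 else 0 := by
  change (Pi.single 0 1 : Fin 8 → ℝ) i = _
  simp [Pi.single_apply]

theorem coord_star (x : Octonion) (i : Fin 8) :
    (star x).coord i = if i = 0 then x.coord i else - x.coord i := rfl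

instance : NonAssocRing Octonion :=
  { (inferInstance : AddCommGroup Octonion), (inferInstance : Mul Octonion),
    (inferInstance : One Octonion) with
    left_distrib := by
      intro a b c; ext i
      fin_cases i <;> simp [coord_mul] <;> ring
    right_distrib := by
      intro a b c; ext i
      fin_cases i <;> simp [coord_mul] <;> ring
    zero_mul := by intro a; ext i; fin_cases i <;> simp [coord_mul]
    mul_zero := by intro a; ext i; fin_cases i <;> simp [coord_mul]
    one_mul := by intro a; ext i; fin_cases i <;> simp [coord_mul, coord_one]
    mul_one := by intro a; ext i; fin_cases i <;> simp [coord_mul, coord_one] }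

instance : StarRing Octonion where
  star_involutive := by
    intro a; ext i
    by_cases h : i = 0 <;> simp [coord_star, h]
  star_mul := by
    intro a b; ext i
    fin_cases i <;> simp [coord_mul, coord_star] <;> ring
  star_add := by
    intro a b; ext i
    by_cases h : i = 0 <;> simp [coord_star, h]; ring

instance : StarModule ℝ Octonion where
  star_smul := by
    intro r a; ext i
    by_cases h : i = 0 <;> simp [coord_star, h]

end Octonion

open Octonion

/-- An order of the octonions containing `ℤ[e₀, …, e₇]`: the additive group generated by a real
basis, stable under multiplication. -/
structure OctonionOrder extends AddSubgroup Octonion where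
  exists_basis : ∃ b : Module.Basis (Fin 8) ℝ Octonion, toAddSubgroup = AddSubgroup.closure (Set.range b)
  mul_mem {x y : Octonion} : x ∈ toAddSubgroup → y ∈ toAddSubgroup → x * y ∈ toAddSubgroup
  e_mem : ∀ i : Fin 8, e i ∈ toAddSubgroup

/-! ### Hermitian octonionic matrices and the group `SL₃(𝕆)` -/

/-- The space `𝕆³`, with its Euclidean norm `‖u‖² = ∑ ‖uᵢ‖²`. -/
abbrev O3 : Type := PiLp 2 (fun _ : Fin 3 => Octonion)

/-- The real vector space `𝔥₃(𝕆)` of Hermitian octonionic matrices of size 3. -/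
def h3 : Submodule ℝ (Matrix (Fin 3) (Fin 3) Octonion) where
  carrier := {M | M.IsHermitian}
  add_mem' := fun ha hb => Matrix.IsHermitian.add ha hb
  zero_mem' := Matrix.isHermitian_zero
  smul_mem' := by
    intro c M hM
    change (c • M).conjTranspose = c • M
    rw [Matrix.conjTranspose_smul, star_trivial, hM]

/-- The identity matrix. -/
def idMat : h3 := ⟨1, Matrix.isHermitian_one⟩

/-- The determinant of a Hermitian octonionic matrix, that is
`αβγ - α‖x‖² - β‖y‖² - γ‖z‖² + 2 Re ((x y) z̄)` for the matrix with diagonal `α, β, γ` and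
`M₁₂ = x`, `M₂₀ = y`, `M₁₀ = z`, `M₀₁ = z̄` (rows and columns numbered from `0`). -/
def det (M : h3) : ℝ :=
  (M.1 0 0).re * (M.1 1 1).re * (M.1 2 2).re
    - ((M.1 0 0).re * ‖M.1 1 2‖ ^ 2 + (M.1 1 1).re * ‖M.1 2 0‖ ^ 2 + (M.1 2 2).re * ‖M.1 1 0‖ ^ 2)
    + 2 * ((M.1 1 2 * M.1 2 0) * M.1 0 1).re

/-- `M` is positive definite: its eigenvalues, i.e. the roots of `t ↦ det (t I - M)` (the diagonal
entries of any diagonalization of `M` by `SU₃(𝕆)`; they are all real), are positive. -/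
def IsPosDef (M : h3) : Prop := ∀ t : ℝ, det (t • idMat - M) = 0 → 0 < t

/-- Positive definite Hermitian octonionic matrices of determinant 1. -/
def PosDefOne : Type := {M : h3 // IsPosDef M ∧ det M = 1}

instance : TopologicalSpace PosDefOne := inferInstanceAs (TopologicalSpace {M : h3 // IsPosDef M ∧ det M = 1})

/-- `SL₃(𝕆) = E₆₍₋₂₆₎`: the group of real linear automorphisms of `𝔥₃(𝕆)` preserving the
determinant. -/
def SL3O : Subgroup (h3 ≃ₗ[ℝ] h3) where
  carrier := {g | ∀ M, det (g M) = det M}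
  mul_mem' := by
    intro a b ha hb M
    change det (a (b M)) = det M
    rw [ha, hb]
  one_mem' := fun _ => rfl
  inv_mem' := by
    intro a ha M
    have h := ha (a.symm M)
    rw [LinearEquiv.apply_symm_apply] at h
    exact h.symm

/-- The Lie group topology on `SL₃(𝕆)`, i.e. the topology of pointwise convergence on the
finite-dimensional space `𝔥₃(𝕆)`. -/
instance : TopologicalSpace SL3O := TopologicalSpace.induced (fun (g : SL3O) (M : h3) => g • M) inferInstance

/-- `SU₃(𝕆)`: the stabilizer of the identity matrix in `SL₃(𝕆)`. -/
def SU3O : Subgroup SL3O := MulAction.stabilizer SL3O idMat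

/-- The symmetric space `SL₃(𝕆) / SU₃(𝕆)`, with the quotient topology and the action of `SL₃(𝕆)`
by left translations. -/
abbrev SymmetricSpace : Type := SL3O ⧸ SU3O

/-! ### Marked lattices and length functions -/

/-- Left multiplication by an octonionic matrix, from `𝒪³` to `𝕆³`. -/
def latticeMap (𝒪 : OctonionOrder) (M : h3) (u : Fin 3 → 𝒪.toAddSubgroup) : O3 :=
  WithLp.toLp 2 (M.1.mulVec fun i => (u i : Octonion))

/-- A marked lattice of determinant one: up to a Euclidean isometry of `𝕆³`, it is the map
`𝒪³ → 𝕆³, u ↦ M u` for a positive definite Hermitian `M` of determinant 1. -/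
def MarkedLattice (𝒪 : OctonionOrder) : Type :=
  {f : (Fin 3 → 𝒪.toAddSubgroup) → O3 //
    ∃ (M : PosDefOne) (k : O3 ≃ₗᵢ[ℝ] O3), ∀ u, f u = k (latticeMap 𝒪 M.1 u)}

/-- The topology of pointwise convergence. -/
instance (𝒪 : OctonionOrder) : TopologicalSpace (MarkedLattice 𝒪) :=
  TopologicalSpace.induced (fun f => f.1) inferInstance

/-- Two marked lattices are isometric if they differ by an isometry of the target. -/
instance latticeSetoid (𝒪 : OctonionOrder) : Setoid (MarkedLattice 𝒪) where
  r f f' := ∃ k : O3 ≃ₗᵢ[ℝ] O3, ∀ u, k (f.1 u) = f'.1 u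
  iseqv :=
    { refl := fun f => ⟨LinearIsometryEquiv.refl ℝ O3, fun _ => rfl⟩
      symm := by
        rintro f f' ⟨k, hk⟩
        exact ⟨k.symm, fun u => by rw [← hk, LinearIsometryEquiv.symm_apply_apply]⟩
      trans := by
        rintro f f' f'' ⟨k, hk⟩ ⟨l, hl⟩
        exact ⟨k.trans l, fun u => by rw [LinearIsometryEquiv.trans_apply, hk, hl]⟩ }

/-- The space of isometry classes of marked lattices, with the quotient topology. -/
def LatticeSpace (𝒪 : OctonionOrder) : Type := Quotient (latticeSetoid 𝒪)

instance (𝒪 : OctonionOrder) : TopologicalSpace (LatticeSpace 𝒪) :=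
  inferInstanceAs (TopologicalSpace (Quotient (latticeSetoid 𝒪)))

/-- The isometry class of the marked lattice `u ↦ M u`. -/
def latticeClass (𝒪 : OctonionOrder) (M : PosDefOne) : LatticeSpace 𝒪 :=
  Quotient.mk (latticeSetoid 𝒪) ⟨latticeMap 𝒪 M.1, M, LinearIsometryEquiv.refl ℝ O3, fun _ => rfl⟩

/-- Nonzero nonnegative functions on `E`, up to multiplication by a positive real. -/
def raySetoid (E : Type*) : Setoid {l : E → ℝ≥0 // l ≠ 0} where
  r l l' := ∃ c : ℝ≥0, 0 < c ∧ l'.1 = c • l.1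
  iseqv :=
    { refl := fun l => ⟨1, one_pos, (one_smul _ _).symm⟩
      symm := by
        rintro l l' ⟨c, hc, h⟩
        exact ⟨c⁻¹, inv_pos.mpr hc, by rw [h, smul_smul, inv_mul_cancel₀ hc.ne', one_smul]⟩
      trans := by
        rintro l l' l'' ⟨c, hc, h⟩ ⟨d, hd, h'⟩
        exact ⟨d * c, mul_pos hd hc, by rw [h', h, smul_smul]⟩ }

/-- The space `ℙ(ℝ₊^E)`, the quotient of `ℝ₊^E ∖ {0}` (product topology) by positive homotheties. -/
def RayProj (E : Type*) : Type _ := Quotient (raySetoid E)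

instance (E : Type*) : TopologicalSpace (RayProj E) :=
  inferInstanceAs (TopologicalSpace (Quotient (raySetoid E)))

theorem det_zero : det 0 = 0 := by
  simp [det, re]

theorem lengthFunction_ne_zero (𝒪 : OctonionOrder) (f : MarkedLattice 𝒪) :
    (fun u => ‖f.1 u‖₊) ≠ 0 := by
  obtain ⟨f, M, k, hf⟩ := f
  intro h
  have h1 : ∀ u, latticeMap 𝒪 M.1 u = 0 := by
    intro u
    have := congrFun h u
    simpa [hf] using this
  have h2 : M.1 = 0 := by
    apply Subtype.ext
    ext1 i j
    have h3 := congrFun (congrArg WithLp.ofLp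
      (h1 (Pi.single j ⟨1, 𝒪.e_mem 0⟩))) i
    have h4 : (fun i => ((Pi.single j ⟨1, 𝒪.e_mem 0⟩ : Fin 3 → 𝒪.toAddSubgroup) i : Octonion))
        = Pi.single j (1 : Octonion) := by
      funext i
      by_cases hij : i = j
      · subst hij; simp
      · simp [hij]
    simp only [latticeMap] at h3
    rw [h4, Matrix.mulVec_single_one] at h3
    exact h3
  have h5 := M.2.2
  rw [h2, det_zero] at h5
  exact zero_ne_one h5

/-- The length function map `[f] ↦ [u ↦ ‖f u‖]`. -/
def lengthMap (𝒪 : OctonionOrder) : LatticeSpace 𝒪 → RayProj (Fin 3 → 𝒪.toAddSubgroup) :=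
  Quotient.map' (s₁ := latticeSetoid 𝒪) (s₂ := raySetoid _)
    (fun f => ⟨fun u => ‖f.1 u‖₊, lengthFunction_ne_zero 𝒪 f⟩) (by
      rintro f f' ⟨k, hk⟩
      refine ⟨1, one_pos, ?_⟩
      funext u
      simp [← hk])

/-! ### Compactifications -/

/-- A continuous extension to `K` of the action of `G` on `X`, along the map `i : X → K`. -/
structure ExtendedAction (G : Type*) [Group G] [TopologicalSpace G] {X K : Type*} [MulAction G X]
    [TopologicalSpace K] (i : X → K) where
  action : MulAction G K
  continuous_action : Continuous fun p : G × K => action.smul p.1 p.2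
  smul_map : ∀ (g : G) (x : X), action.smul g (i x) = i (g • x)

/-- `(K, i)` is a `G`-compactification of `X`: `K` is compact (and Hausdorff), `i` is an embedding
with dense image and the action of `G` on `X` extends continuously to `K`. -/
structure IsGCompactification (G : Type*) [Group G] [TopologicalSpace G] {X K : Type*}
    [TopologicalSpace X] [MulAction G X] [TopologicalSpace K] (i : X → K) : Prop where
  compactSpace : CompactSpace K
  t2Space : T2Space K
  isEmbedding : IsEmbedding i
  denseRange : DenseRange i
  extends_action : Nonempty (ExtendedAction G i)

/-- The `G`-compactifications `(K, i)` and `(K', i')` of `X` are `G`-isomorphic: there is a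
homeomorphism `F : K → K'` with `i' = F ∘ i`, equivariant for the extended actions (which are
unique, the images of `i` and `i'` being dense). -/
def GIsomorphic (G : Type*) [Group G] [TopologicalSpace G] {X K K' : Type*} [MulAction G X]
    [TopologicalSpace K] [TopologicalSpace K'] (i : X → K) (i' : X → K') : Prop :=
  ∃ F : K ≃ₜ K', i' = F ∘ i ∧
    ∀ (a : ExtendedAction G i) (a' : ExtendedAction G i') (g : G) (k : K),
      F (a.action.smul g k) = a'.action.smul g (F k)

/-- The corestriction of a map to the closure of its image. -/
def toClosure {X Y : Type*} [TopologicalSpace Y] (φ : X → Y) (x : X) : closure (Set.range φ) :=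
  ⟨φ x, subset_closure (Set.mem_range_self x)⟩

/-- The quotient topology on a real projective space. -/
instance projTopology (V : Type*) [AddCommGroup V] [Module ℝ V] [TopologicalSpace V] :
    TopologicalSpace (Projectivization ℝ V) :=
  inferInstanceAs (TopologicalSpace (Quotient (projectivizationSetoid ℝ V)))

theorem smul_idMat_ne_zero (g : SL3O) : g • idMat ≠ 0 := by
  intro h
  have h1 : det (g • idMat) = det idMat := g.2 idMat
  rw [h, det_zero] at h1
  simp [det, idMat, re, coord_one] at h1

/-- The Satake map `SL₃(𝕆) / SU₃(𝕆) → ℙ(𝔥₃(𝕆))`, `g SU₃(𝕆) ↦ ℝ (g · I)`. -/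
def satakeMap : SymmetricSpace → Projectivization ℝ h3 :=
  Quotient.lift (fun g : SL3O => Projectivization.mk ℝ (g • idMat) (smul_idMat_ne_zero g)) (by
    intro a b hab
    have h : a⁻¹ * b ∈ SU3O := QuotientGroup.leftRel_apply.mp hab
    have h1 : (a⁻¹ * b) • idMat = idMat := h
    have h2 : a • idMat = b • idMat := by
      rw [mul_smul] at h1
      rw [← h1, smul_inv_smul, h1]
    simp only [h2])

end OctonionicSatake

end

noncomputable section

namespace OctonionicSatake

/-! ### Octonion arithmetic: adjoints, alternativity, multiplicativity of the norm, continuity. -/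

namespace Octonion

/-! Both compactifications are copies of one compact space: the set `PsdSphere` of positive
semidefinite matrices `N` of norm 1 for the trace form. Radial projection embeds the positive
definite matrices of determinant 1 in it with dense image. Two continuous maps leave it, `N ↦ ℝ N²`
to the projective space and `N ↦ [u ↦ ‖N u‖]` to the space of rays. Evaluated at the square root of
`g • I`, they give the Satake map and the Thurston map respectively. Both are injective into
Hausdorff spaces, hence closed embeddings, so each closure is the image of the sphere
(`exists_homeomorph_closure`). The action of `SL₃(𝕆)` is visibly continuous on the projective space;
it restricts to the Satake closure and is transported to the sphere, then to the Thurston closure.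
Equivariance of the resulting homeomorphism follows by density.

Injectivity has two ingredients. A positive semidefinite matrix is determined by its square
(`Psd.eq_of_sqr_eq`), and the trace of `N²` is 1 on the sphere, which removes the scalar ambiguity.
The length function determines the square (`sqr_eq_smul_of_norm_latticeMap`): vectors whose nonzero
entries are basis units, with a 1 among them when there are two, read off every entry of `N²`
without associativity.

The spectral theory rests on two facts. Elements fixing `I` preserve the characteristic polynomial,
hence the trace form, the adjugate and the square. Every matrix is diagonalized by such an element
(`exists_smul_eq_diagonal`): maximize the sum of squares of the diagonal entries on the compact
orbit, since a nonzero off-diagonal entry would let a plane rotation increase it. Positivity of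
eigenvalues then becomes positivity of minors, and square roots exist.

For the orbit of `I`, each `g • I` is positive definite because the determinant is hyperbolic in its
direction (`isPosDef_smul_idMat`). Conversely, Cholesky reduction by transvections and cyclic
permutations gives a section of `g ↦ g • I` that is manifestly continuous, hence the homeomorphism
`orbitHomeo`. -/

instance : IsScalarTower ℝ Octonion Octonion where
  smul_assoc r x y := by
    ext i
    simp only [smul_eq_mul]
    fin_cases i <;> simp [coord_mul] <;> ring

instance : SMulCommClass ℝ Octonion Octonion where
  smul_comm r x y := by
    ext i
    simp only [smul_eq_mul]
    fin_cases i <;> simp [coord_mul] <;> ring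

theorem inner_eq_sum (x y : Octonion) : inner ℝ x y = ∑ i, x.coord i * y.coord i := by
  refine (PiLp.inner_apply (𝕜 := ℝ) (x : EuclideanSpace ℝ (Fin 8)) y).trans ?_
  refine Finset.sum_congr rfl fun i _ => ?_
  change y.coord i * x.coord i = _
  ring

theorem norm_sq_eq_sum (x : Octonion) : ‖x‖ ^ 2 = ∑ i, x.coord i ^ 2 := by
  rw [← real_inner_self_eq_norm_sq, inner_eq_sum]
  simp only [sq]

theorem re_add (x y : Octonion) : (x + y).re = x.re + y.re := rfl
theorem re_smul (r : ℝ) (x : Octonion) : (r • x).re = r * x.re := rfl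
@[simp] theorem re_zero : (0 : Octonion).re = 0 := rfl
@[simp] theorem re_one : (1 : Octonion).re = 1 := rfl

theorem re_mul (x y : Octonion) : (x * y).re = inner ℝ x (star y) := by
  rw [inner_eq_sum]
  simp [re, coord_mul, coord_star, Fin.sum_univ_eight]
  ring

/-- Multiplication by `a` has multiplication by its conjugate as adjoint. With its right-hand
version and alternativity, this replaces associativity in everything that follows. -/
theorem inner_mul_left (a x y : Octonion) : inner ℝ (a * x) y = inner ℝ x (star a * y) := by
  simp [inner_eq_sum, coord_mul, coord_star, Fin.sum_univ_eight]
  ring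

theorem inner_mul_right (a x y : Octonion) : inner ℝ (x * a) y = inner ℝ x (y * star a) := by
  simp [inner_eq_sum, coord_mul, coord_star, Fin.sum_univ_eight]
  ring

@[simp] theorem inner_star_star (x y : Octonion) : inner ℝ (star x) (star y) = inner ℝ x y := by
  simp [inner_eq_sum, coord_star, Fin.sum_univ_eight]

theorem inner_star_left (x y : Octonion) : inner ℝ (star x) y = inner ℝ x (star y) := by
  rw [← inner_star_star, star_star]

@[simp] protected theorem norm_star (x : Octonion) : ‖star x‖ = ‖x‖ := by
  rw [← sq_eq_sq₀ (norm_nonneg _) (norm_nonneg _), ← real_inner_self_eq_norm_sq, inner_star_star,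
    real_inner_self_eq_norm_sq]

/-- A form of alternativity; together with the adjoint rule it makes the norm multiplicative. -/
theorem star_mul_mul (x y : Octonion) : star x * (x * y) = ‖x‖ ^ 2 • y := by
  rw [norm_sq_eq_sum]
  ext i
  fin_cases i <;> simp [coord_mul, coord_star, Fin.sum_univ_eight] <;> ring

theorem mul_star_mul (x y : Octonion) : x * (star x * y) = ‖x‖ ^ 2 • y := by
  have := star_mul_mul (star x) y
  rwa [star_star, Octonion.norm_star] at this

theorem mul_mul_star (x y : Octonion) : x * y * star y = ‖y‖ ^ 2 • x := by
  have := congrArg star (mul_star_mul y (star x))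
  simpa only [star_mul, star_star, star_smul, star_trivial] using this

theorem mul_star_self (x : Octonion) : x * star x = ‖x‖ ^ 2 • (1 : Octonion) := by
  simpa using mul_star_mul x 1

theorem star_mul_self (x : Octonion) : star x * x = ‖x‖ ^ 2 • (1 : Octonion) := by
  simpa using star_mul_mul x 1

protected theorem norm_mul (x y : Octonion) : ‖x * y‖ = ‖x‖ * ‖y‖ := by
  rw [← sq_eq_sq₀ (norm_nonneg _) (by positivity), ← real_inner_self_eq_norm_sq, inner_mul_left,
    star_mul_mul, real_inner_smul_right, real_inner_self_eq_norm_sq, mul_pow]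

theorem norm_e (i : Fin 8) : ‖e i‖ = 1 := by
  rw [← sq_eq_sq₀ (norm_nonneg _) zero_le_one, norm_sq_eq_sum]
  simp [e, Pi.single_apply]

theorem inner_e_left (i : Fin 8) (x : Octonion) : inner ℝ (e i) x = x.coord i := by
  rw [inner_eq_sum]
  simp [e, Pi.single_apply]

@[simp] protected theorem norm_one : ‖(1 : Octonion)‖ = 1 := norm_e 0

/-- The trilinear form `Re ((x y) w)` is invariant under cyclic permutations. -/
theorem re_mul_mul_cycle (x y w : Octonion) : ((x * y) * w).re = ((y * w) * x).re := by
  rw [re_mul, re_mul, inner_mul_left, inner_mul_right, ← inner_star_star]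

theorem re_mul_mul_star (x y w : Octonion) :
    ((star x * star w) * star y).re = ((x * y) * w).re := by
  rw [re_mul_mul_cycle x y w, re_mul, re_mul, star_star, inner_mul_right, star_star,
    real_inner_comm]

theorem continuous_coord (i : Fin 8) : Continuous fun x : Octonion => x.coord i :=
  (continuous_apply i).comp (PiLp.continuous_ofLp 2 (fun _ : Fin 8 => ℝ))

theorem continuous_iff_coord {X : Type*} [TopologicalSpace X] {f : X → Octonion} :
    Continuous f ↔ ∀ i, Continuous fun x => (f x).coord i := by
  refine ⟨fun h i => (continuous_coord i).comp h, fun h => ?_⟩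
  exact (PiLp.continuous_toLp 2 (fun _ : Fin 8 => ℝ)).comp (continuous_pi h)

theorem continuous_re : Continuous re := continuous_coord 0

instance : ContinuousMul Octonion where
  continuous_mul := by
    have h1 : ∀ i, Continuous fun p : Octonion × Octonion => p.1.coord i := fun i =>
      (continuous_coord i).comp continuous_fst
    have h2 : ∀ i, Continuous fun p : Octonion × Octonion => p.2.coord i := fun i =>
      (continuous_coord i).comp continuous_snd
    rw [continuous_iff_coord]
    intro i
    fin_cases i <;> simp [coord_mul] <;> fun_prop

instance : ContinuousStar Octonion where
  continuous_star := by
    rw [continuous_iff_coord]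
    intro i
    by_cases h : i = 0
    · simpa [coord_star, h] using continuous_coord 0
    · simp only [coord_star, h, if_false]
      exact (continuous_coord i).neg

end Octonion

open Octonion

/-! ### Coordinates on Hermitian matrices. -/

/-- A Hermitian matrix from its diagonal and its entries in positions `12`, `20`, `01`. -/
def herm (a b c : ℝ) (x y w : Octonion) : h3 :=
  ⟨!![a • 1, w, star y; star w, b • 1, x; y, star x, c • 1], by
    ext i j
    fin_cases i <;> fin_cases j <;> simp⟩

/-- The off-diagonal coordinates `oX`, `oY`, `oW` sit in positions `12`, `20`, `01`, opposite to the
diagonal entries `dA`, `dB`, `dC`. Formulas are thus invariant under simultaneous cyclic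
permutation; `oW` is the conjugate of the `z` of the determinant. -/
def dA : h3 →ₗ[ℝ] ℝ where
  toFun M := (M.1 0 0).re
  map_add' _ _ := rfl
  map_smul' _ _ := rfl

def dB : h3 →ₗ[ℝ] ℝ where
  toFun M := (M.1 1 1).re
  map_add' _ _ := rfl
  map_smul' _ _ := rfl

def dC : h3 →ₗ[ℝ] ℝ where
  toFun M := (M.1 2 2).re
  map_add' _ _ := rfl
  map_smul' _ _ := rfl

def oX : h3 →ₗ[ℝ] Octonion where
  toFun M := M.1 1 2
  map_add' _ _ := rfl
  map_smul' _ _ := rfl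

def oY : h3 →ₗ[ℝ] Octonion where
  toFun M := M.1 2 0
  map_add' _ _ := rfl
  map_smul' _ _ := rfl

def oW : h3 →ₗ[ℝ] Octonion where
  toFun M := M.1 0 1
  map_add' _ _ := rfl
  map_smul' _ _ := rfl

theorem dA_apply (M : h3) : dA M = (M.1 0 0).re := rfl
theorem dB_apply (M : h3) : dB M = (M.1 1 1).re := rfl
theorem dC_apply (M : h3) : dC M = (M.1 2 2).re := rfl
theorem oX_apply (M : h3) : oX M = M.1 1 2 := rfl
theorem oY_apply (M : h3) : oY M = M.1 2 0 := rfl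
theorem oW_apply (M : h3) : oW M = M.1 0 1 := rfl

section coords
variable (a b c : ℝ) (x y w : Octonion)
@[simp] theorem dA_herm : dA (herm a b c x y w) = a := by simp [dA_apply, herm, re_smul]
@[simp] theorem dB_herm : dB (herm a b c x y w) = b := by simp [dB_apply, herm, re_smul]
@[simp] theorem dC_herm : dC (herm a b c x y w) = c := by simp [dC_apply, herm, re_smul]
@[simp] theorem oX_herm : oX (herm a b c x y w) = x := by simp [oX_apply, herm]
@[simp] theorem oY_herm : oY (herm a b c x y w) = y := by simp [oY_apply, herm]
@[simp] theorem oW_herm : oW (herm a b c x y w) = w := by simp [oW_apply, herm]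
end coords

theorem Octonion.eq_re_smul_one_of_star_eq {x : Octonion} (h : star x = x) : x = x.re • 1 := by
  ext i
  have := congrArg (fun z => coord z i) h
  simp only [coord_star] at this
  by_cases hi : i = 0
  · simp [hi, re, coord_one]
  · simp only [hi, if_false] at this
    simp [hi, coord_one]
    linarith

theorem star_entry (M : h3) (i j : Fin 3) : star (M.1 i j) = M.1 j i :=
  congrFun (congrFun M.2 j) i

theorem herm_coords (M : h3) : herm (dA M) (dB M) (dC M) (oX M) (oY M) (oW M) = M := by
  apply Subtype.ext
  ext1 i j
  have h := fun i => (eq_re_smul_one_of_star_eq (star_entry M i i)).symm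
  fin_cases i <;> fin_cases j <;>
    simp [herm, dA_apply, dB_apply, dC_apply, oX_apply, oY_apply, oW_apply, h, star_entry]

theorem h3_ext {M N : h3} (hA : dA M = dA N) (hB : dB M = dB N) (hC : dC M = dC N)
    (hX : oX M = oX N) (hY : oY M = oY N) (hW : oW M = oW N) : M = N := by
  rw [← herm_coords M, ← herm_coords N, hA, hB, hC, hX, hY, hW]

theorem continuous_entry (i j : Fin 3) : Continuous fun M : h3 => M.1 i j :=
  (continuous_apply_apply i j).comp continuous_subtype_val

@[fun_prop] theorem continuous_dA : Continuous dA := continuous_re.comp (continuous_entry 0 0)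
@[fun_prop] theorem continuous_dB : Continuous dB := continuous_re.comp (continuous_entry 1 1)
@[fun_prop] theorem continuous_dC : Continuous dC := continuous_re.comp (continuous_entry 2 2)
@[fun_prop] theorem continuous_oX : Continuous oX := continuous_entry 1 2
@[fun_prop] theorem continuous_oY : Continuous oY := continuous_entry 2 0
@[fun_prop] theorem continuous_oW : Continuous oW := continuous_entry 0 1

@[fun_prop] theorem _root_.Continuous.herm {T : Type*} [TopologicalSpace T] {a b c : T → ℝ}
    {x y w : T → Octonion} (ha : Continuous a) (hb : Continuous b) (hc : Continuous c)
    (hx : Continuous x) (hy : Continuous y) (hw : Continuous w) :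
    Continuous fun t => herm (a t) (b t) (c t) (x t) (y t) (w t) := by
  refine Continuous.subtype_mk (continuous_matrix fun i j => ?_) _
  fin_cases i <;> fin_cases j <;> simp <;> fun_prop

theorem det_eq (M : h3) : det M = dA M * dB M * dC M - (dA M * ‖oX M‖ ^ 2 + dB M * ‖oY M‖ ^ 2
    + dC M * ‖oW M‖ ^ 2) + 2 * ((oX M * oY M) * oW M).re := by
  rw [det, show ‖M.1 1 0‖ = ‖oW M‖ by rw [← star_entry, Octonion.norm_star]; rfl]
  rfl

theorem idMat_eq : idMat = herm 1 1 1 0 0 0 := by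
  apply Subtype.ext
  ext1 i j
  fin_cases i <;> fin_cases j <;> simp [idMat, herm]

@[fun_prop] theorem continuous_re' {T : Type*} [TopologicalSpace T] {f : T → Octonion}
    (hf : Continuous f) : Continuous fun t => (f t).re := continuous_re.comp hf

@[fun_prop] theorem continuous_det : Continuous det := by
  simp only [funext det_eq]
  fun_prop

/-! ### Trace form, adjugate, square and characteristic polynomial. -/

/-- The trace form. -/
def inn (M N : h3) : ℝ := dA M * dA N + dB M * dB N + dC M * dC N
  + 2 * (inner ℝ (oX M) (oX N) + inner ℝ (oY M) (oY N) + inner ℝ (oW M) (oW N))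

def tr : h3 →ₗ[ℝ] ℝ := dA + dB + dC

theorem tr_apply (M : h3) : tr M = dA M + dB M + dC M := rfl

/-- The sum of the principal minors of size 2. -/
def sigma (M : h3) : ℝ := dA M * dB M + dB M * dC M + dC M * dA M
  - (‖oX M‖ ^ 2 + ‖oY M‖ ^ 2 + ‖oW M‖ ^ 2)

/-- The adjugate matrix. -/
def sharp (M : h3) : h3 := herm (dB M * dC M - ‖oX M‖ ^ 2) (dC M * dA M - ‖oY M‖ ^ 2)
  (dA M * dB M - ‖oW M‖ ^ 2) (star (oY M * oW M) - dA M • oX M) (star (oW M * oX M) - dB M • oY M)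
  (star (oX M * oY M) - dC M • oW M)

/-- The square of a Hermitian matrix. -/
def sqr (M : h3) : h3 := sharp M + tr M • M - sigma M • idMat

theorem sqr_eq (M : h3) : sqr M = herm (dA M ^ 2 + ‖oY M‖ ^ 2 + ‖oW M‖ ^ 2)
    (dB M ^ 2 + ‖oX M‖ ^ 2 + ‖oW M‖ ^ 2) (dC M ^ 2 + ‖oX M‖ ^ 2 + ‖oY M‖ ^ 2)
    (star (oY M * oW M) + (dB M + dC M) • oX M) (star (oW M * oX M) + (dC M + dA M) • oY M)
    (star (oX M * oY M) + (dA M + dB M) • oW M) := by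
  apply h3_ext <;> simp [sqr, sharp, idMat_eq, tr_apply, sigma]
  all_goals first | ring1 | module

theorem coe_sqr (M : h3) : (sqr M).1 = M.1 * M.1 := by
  rw [sqr_eq]
  conv_rhs => rw [← herm_coords M]
  generalize dA M = a, dB M = b, dC M = c, oX M = x, oY M = y, oW M = w
  ext1 i j
  fin_cases i <;> fin_cases j <;>
    simp [herm, Matrix.mul_apply, Fin.sum_univ_three, mul_star_self, star_mul_self]
  all_goals module

theorem det_herm (a b c : ℝ) (x y w : Octonion) : det (herm a b c x y w) =
    a * b * c - (a * ‖x‖ ^ 2 + b * ‖y‖ ^ 2 + c * ‖w‖ ^ 2) + 2 * ((x * y) * w).re := by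
  simp [det_eq]

theorem det_smul (r : ℝ) (M : h3) : det (r • M) = r ^ 3 * det M := by
  simp only [det_eq, map_smul, smul_eq_mul, norm_smul, smul_mul_assoc, mul_smul_comm, re_smul,
    mul_pow, Real.norm_eq_abs, sq_abs]
  ring

theorem norm_sub_sq' (x y : Octonion) : ‖x - y‖ ^ 2 = ‖x‖ ^ 2 - 2 * inner ℝ x y + ‖y‖ ^ 2 :=
  norm_sub_sq_real x y

theorem re_sub (x y : Octonion) : (x - y).re = x.re - y.re := rfl
theorem re_neg (x : Octonion) : (-x).re = -x.re := rfl

/-- The part of `det (M + N)` that is odd in `N` consists of a linear term, which is the pairing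
with the adjugate, and of `det N`. The adjugate is thereby expressed through the determinant and the
trace form alone, which makes it invariant under maps preserving both. -/
theorem inn_sharp (M N : h3) :
    inn (sharp M) N = (det (M + N) - det (M - N)) / 2 - det N := by
  have h1 : inner ℝ (star (oY M * oW M)) (oX N) = ((oX N * oY M) * oW M).re := by
    rw [re_mul_mul_cycle, re_mul, inner_star_left]
  have h2 : inner ℝ (star (oW M * oX M)) (oY N) = ((oX M * oY N) * oW M).re := by
    rw [re_mul_mul_cycle, re_mul_mul_cycle, re_mul, inner_star_left]
  have h3 : inner ℝ (star (oX M * oY M)) (oW N) = ((oX M * oY M) * oW N).re := by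
    rw [re_mul, inner_star_left]
  simp only [inn, sharp, det_eq, map_add, map_sub, dA_herm, dB_herm, dC_herm, oX_herm, oY_herm,
    oW_herm, inner_sub_left, real_inner_smul_left, h1, h2, h3, norm_sub_sq', norm_add_sq_real,
    add_mul, mul_add, sub_mul, mul_sub, re_add, re_sub]
  ring

theorem det_smul_idMat_sub (t : ℝ) (M : h3) :
    det (t • idMat - M) = t ^ 3 - tr M * t ^ 2 + sigma M * t - det M := by
  simp [det_eq, idMat_eq, tr_apply, sigma, re_neg]
  ring

theorem det_smul_idMat_add (t : ℝ) (M : h3) :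
    det (t • idMat + M) = t ^ 3 + tr M * t ^ 2 + sigma M * t + det M := by
  simp [det_eq, idMat_eq, tr_apply, sigma]
  ring

theorem inn_self (M : h3) : inn M M = tr M ^ 2 - 2 * sigma M := by
  simp only [inn, tr_apply, sigma, real_inner_self_eq_norm_sq]
  ring

theorem tr_sqr (M : h3) : tr (sqr M) = inn M M := by
  rw [sqr_eq]
  simp only [inn, tr_apply, real_inner_self_eq_norm_sq, dA_herm, dB_herm, dC_herm]
  ring

theorem inn_eq_polar (M N : h3) : inn M N = (inn (M + N) (M + N) - inn M M - inn N N) / 2 := by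
  simp only [inn, map_add, inner_add_left, inner_add_right]
  rw [real_inner_comm (oX M) (oX N), real_inner_comm (oY M) (oY N), real_inner_comm (oW M) (oW N)]
  ring

theorem inn_sub_left (M N P : h3) : inn (M - N) P = inn M P - inn N P := by
  simp only [inn, map_sub, inner_sub_left]
  ring

theorem inn_smul_smul (r : ℝ) (M : h3) : inn (r • M) (r • M) = r ^ 2 * inn M M := by
  simp only [inn, map_smul, smul_eq_mul, real_inner_smul_left, real_inner_smul_right]
  ring

theorem inn_self_nonneg (M : h3) : 0 ≤ inn M M := by
  simp only [inn, real_inner_self_eq_norm_sq]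
  nlinarith [mul_self_nonneg (dA M), mul_self_nonneg (dB M), mul_self_nonneg (dC M),
    sq_nonneg ‖oX M‖, sq_nonneg ‖oY M‖, sq_nonneg ‖oW M‖]

theorem eq_zero_of_inn_self {M : h3} (h : inn M M = 0) : M = 0 := by
  simp only [inn, real_inner_self_eq_norm_sq] at h
  have h1 := mul_self_nonneg (dA M)
  have h2 := mul_self_nonneg (dB M)
  have h3 := mul_self_nonneg (dC M)
  have h4 := sq_nonneg ‖oX M‖
  have h5 := sq_nonneg ‖oY M‖
  have h6 := sq_nonneg ‖oW M‖
  apply h3_ext <;> simp only [map_zero]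
  · exact mul_self_eq_zero.mp (by linarith)
  · exact mul_self_eq_zero.mp (by linarith)
  · exact mul_self_eq_zero.mp (by linarith)
  · exact norm_eq_zero.mp (pow_eq_zero_iff two_ne_zero |>.mp (by linarith))
  · exact norm_eq_zero.mp (pow_eq_zero_iff two_ne_zero |>.mp (by linarith))
  · exact norm_eq_zero.mp (pow_eq_zero_iff two_ne_zero |>.mp (by linarith))

@[fun_prop] theorem continuous_inn {T : Type*} [TopologicalSpace T] {f g : T → h3}
    (hf : Continuous f) (hg : Continuous g) : Continuous fun t => inn (f t) (g t) := by
  unfold inn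
  fun_prop

@[fun_prop] theorem continuous_sqr : Continuous sqr := by
  simp only [funext sqr_eq]
  fun_prop

/-! ### Maps preserving the determinant, and elementary elements of the group. -/

/-- Nondegeneracy of the cubic form. Diagonal test matrices isolate the diagonal of `N`; then a test
matrix containing an off-diagonal entry of `N` produces the squared norm of that entry. -/
theorem eq_zero_of_inn_sharp {N : h3} (h : ∀ M, inn (sharp M) N = 0) : N = 0 := by
  have hA : dA N = 0 := by simpa [inn, sharp] using h (herm 0 1 1 0 0 0)
  have hB : dB N = 0 := by simpa [inn, sharp] using h (herm 1 0 1 0 0 0)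
  have hC : dC N = 0 := by simpa [inn, sharp] using h (herm 1 1 0 0 0 0)
  have hX : oX N = 0 := by simpa [inn, sharp, hA] using h (herm 1 0 0 (oX N) 0 0)
  have hY : oY N = 0 := by simpa [inn, sharp, hB] using h (herm 0 1 0 0 (oY N) 0)
  have hW : oW N = 0 := by simpa [inn, sharp, hC] using h (herm 0 0 1 0 0 (oW N))
  apply h3_ext <;> simpa

/-- A vector of the kernel pairs to zero with every adjugate. Invertibility thus never has to be
checked separately when elements of `SL3O` are built. -/
theorem injective_of_det {f : h3 →ₗ[ℝ] h3} (h : ∀ M, det (f M) = det M) :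
    Function.Injective f := by
  rw [injective_iff_map_eq_zero]
  intro N hN
  refine eq_zero_of_inn_sharp fun M => ?_
  rw [inn_sharp, ← h (M + N), ← h (M - N), ← h N, map_add, map_sub, hN, det_zero]
  simp

/-- A linear map preserving the determinant, as an element of `SL₃(𝕆)`. -/
def SL3O.ofLinear (f : h3 →ₗ[ℝ] h3) (h : ∀ M, det (f M) = det M) : SL3O :=
  ⟨LinearEquiv.ofInjectiveEndo f (injective_of_det h), h⟩

theorem det_smul_eq (g : SL3O) (M : h3) : det (g • M) = det M := g.2 M

theorem SL3O.smul_add' (g : SL3O) (M N : h3) : g • (M + N) = g • M + g • N := map_add g.1 M N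
theorem SL3O.smul_sub' (g : SL3O) (M N : h3) : g • (M - N) = g • M - g • N := map_sub g.1 M N
theorem SL3O.smul_smul' (g : SL3O) (r : ℝ) (M : h3) : g • (r • M) = r • (g • M) := map_smul g.1 r M

/-- Adding `a` times the last row to the middle row (and symmetrically for columns). -/
def transvection (a : Octonion) : SL3O :=
  SL3O.ofLinear
    { toFun := fun M => herm (dA M) (dB M + 2 * inner ℝ a (oX M) + ‖a‖ ^ 2 * dC M) (dC M)
        (oX M + dC M • a) (oY M) (oW M + star (a * oY M))
      map_add' := fun M N => by
        apply h3_ext <;> simp [inner_add_right, mul_add, -star_mul]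
        any_goals ring1
        all_goals module
      map_smul' := fun r M => by
        apply h3_ext <;> simp [inner_smul_right, mul_smul_comm, -star_mul]
        · ring
        · module } (by
      intro M
      -- The trilinear terms created by the transvection; adjunction, alternativity and
      -- multiplicativity of the norm suffice to evaluate them.
      have h1 : ((oX M * oY M) * star (a * oY M)).re = ‖oY M‖ ^ 2 * inner ℝ a (oX M) := by
        rw [re_mul, star_star, inner_mul_right, mul_mul_star, inner_smul_right, real_inner_comm]
      have h2 : ((a * oY M) * star (a * oY M)).re = ‖a‖ ^ 2 * ‖oY M‖ ^ 2 := by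
        rw [mul_star_self, Octonion.norm_mul, re_smul]
        simp [mul_pow]
      have h3 : ((a * oY M) * oW M).re = inner ℝ (oW M) (star (a * oY M)) := by
        rw [re_mul, ← inner_star_star, star_star, real_inner_comm]
      simp only [LinearMap.coe_mk, AddHom.coe_mk, det_eq, dA_herm, dB_herm, dC_herm, oX_herm,
        oY_herm, oW_herm, norm_add_sq_real, norm_smul, Octonion.norm_star, Octonion.norm_mul, add_mul, mul_add,
        smul_mul_assoc, re_add, re_smul, h1, h2, h3, inner_smul_right, mul_pow, Real.norm_eq_abs,
        sq_abs, real_inner_comm a (oX M)]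
      ring)

theorem transvection_smul (a : Octonion) (M : h3) : transvection a • M =
    herm (dA M) (dB M + 2 * inner ℝ a (oX M) + ‖a‖ ^ 2 * dC M) (dC M)
        (oX M + dC M • a) (oY M) (oW M + star (a * oY M)) := rfl

/-- The cyclic permutation of rows and columns. -/
def cyclic : SL3O :=
  SL3O.ofLinear
    { toFun := fun M => herm (dB M) (dC M) (dA M) (oY M) (oW M) (oX M)
      map_add' := fun M N => by apply h3_ext <;> simp
      map_smul' := fun r M => by apply h3_ext <;> simp } (by
      intro M
      simp only [LinearMap.coe_mk, AddHom.coe_mk, det_eq, dA_herm, dB_herm, dC_herm, oX_herm,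
        oY_herm, oW_herm, re_mul_mul_cycle (oX M)]
      ring)

theorem cyclic_smul (M : h3) :
    cyclic • M = herm (dB M) (dC M) (dA M) (oY M) (oW M) (oX M) := rfl

/-- The transposition of the last two rows and columns. -/
def flip : SL3O :=
  SL3O.ofLinear
    { toFun := fun M => herm (dA M) (dC M) (dB M) (star (oX M)) (star (oW M)) (star (oY M))
      map_add' := fun M N => by apply h3_ext <;> simp
      map_smul' := fun r M => by apply h3_ext <;> simp } (by
      intro M
      simp only [LinearMap.coe_mk, AddHom.coe_mk, det_eq, dA_herm, dB_herm, dC_herm, oX_herm,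
        oY_herm, oW_herm, re_mul_mul_star, Octonion.norm_star]
      ring)

theorem flip_smul (M : h3) :
    flip • M = herm (dA M) (dC M) (dB M) (star (oX M)) (star (oW M)) (star (oY M)) := rfl

/-- Conjugation by a real diagonal matrix. -/
def diagonal (p q r : ℝ) (h : p * q * r = 1) : SL3O :=
  SL3O.ofLinear
    { toFun := fun M => herm (p ^ 2 * dA M) (q ^ 2 * dB M) (r ^ 2 * dC M) ((q * r) • oX M)
        ((r * p) • oY M) ((p * q) • oW M)
      map_add' := fun M N => by apply h3_ext <;> simp [mul_add]
      map_smul' := fun s M => by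
        apply h3_ext <;> simp
        any_goals ring1
        all_goals module } (by
      intro M
      have h2 : (p * q * r) ^ 2 = 1 := by rw [h, one_pow]
      simp only [LinearMap.coe_mk, AddHom.coe_mk, det_eq, dA_herm, dB_herm, dC_herm, oX_herm,
        oY_herm, oW_herm, norm_smul, mul_pow, Real.norm_eq_abs, sq_abs, smul_mul_assoc,
        mul_smul_comm, re_smul]
      linear_combination (dA M * dB M * dC M - (dA M * ‖oX M‖ ^ 2 + dB M * ‖oY M‖ ^ 2
        + dC M * ‖oW M‖ ^ 2) + 2 * ((oX M * oY M) * oW M).re) * h2)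

theorem diagonal_smul (p q r : ℝ) (h : p * q * r = 1) (M : h3) : diagonal p q r h • M =
    herm (p ^ 2 * dA M) (q ^ 2 * dB M) (r ^ 2 * dC M) ((q * r) • oX M)
        ((r * p) • oY M) ((p * q) • oW M) := rfl

/-! ### Invariants of `SU₃(𝕆)` -/

section stabilizer
variable {k : SL3O} (hk : k • idMat = idMat)
include hk

/-- The characteristic polynomial is invariant; its coefficients give the invariance of the trace,
of `sigma` and so of the trace form. -/
theorem det_smul_idMat_sub_smul (t : ℝ) (M : h3) :
    det (t • idMat - k • M) = det (t • idMat - M) := by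
  rw [← det_smul_eq k (t • idMat - M), SL3O.smul_sub', SL3O.smul_smul', hk]

theorem tr_smul (M : h3) : tr (k • M) = tr M := by
  have h1 := det_smul_idMat_sub_smul hk 1 M
  have h2 := det_smul_idMat_sub_smul hk (-1) M
  simp only [det_smul_idMat_sub, det_smul_eq] at h1 h2
  linarith

theorem sigma_smul (M : h3) : sigma (k • M) = sigma M := by
  have h1 := det_smul_idMat_sub_smul hk 1 M
  have h2 := det_smul_idMat_sub_smul hk (-1) M
  simp only [det_smul_idMat_sub, det_smul_eq] at h1 h2
  linarith

theorem inn_smul (M N : h3) : inn (k • M) (k • N) = inn M N := by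
  rw [inn_eq_polar, inn_eq_polar M, ← SL3O.smul_add']
  simp only [inn_self, tr_smul hk, sigma_smul hk]

theorem sharp_smul (M : h3) : sharp (k • M) = k • sharp M := by
  rw [← sub_eq_zero]
  apply eq_zero_of_inn_self
  -- Both pairings are computed from the determinant by `inn_sharp`, after writing the test matrix
  -- as a translate by `k`.
  have : ∀ N, inn (sharp (k • M)) N = inn (k • sharp M) N := by
    intro N
    obtain ⟨N, rfl⟩ : ∃ N', k • N' = N := ⟨k⁻¹ • N, smul_inv_smul k N⟩
    rw [inn_smul hk, inn_sharp, inn_sharp, ← SL3O.smul_add', ← SL3O.smul_sub']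
    simp only [det_smul_eq]
  rw [inn_sub_left, this, sub_self]

theorem sqr_smul (M : h3) : sqr (k • M) = k • sqr M := by
  rw [sqr, sharp_smul hk, tr_smul hk, sigma_smul hk, sqr, SL3O.smul_sub', SL3O.smul_add',
    SL3O.smul_smul', SL3O.smul_smul', hk]

theorem inv_smul_idMat : k⁻¹ • idMat = idMat := by
  rw [inv_smul_eq_iff, hk]

end stabilizer

theorem cyclic_smul_idMat : cyclic • idMat = idMat := by
  rw [idMat_eq, cyclic_smul]
  simp

/-! ### Compactness of the orbits of the stabilizer. -/

theorem isCompact_inn_le (R : ℝ) : IsCompact {M : h3 | inn M M ≤ R} := by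
  let B : Set Octonion := Metric.closedBall 0 (√|R|)
  let I : Set ℝ := Metric.closedBall 0 (√|R|)
  have hB : IsCompact B := isCompact_closedBall _ _
  have hI : IsCompact I := isCompact_closedBall _ _
  have h : IsCompact ((fun p : (ℝ × ℝ × ℝ) × (Octonion × Octonion × Octonion) =>
      herm p.1.1 p.1.2.1 p.1.2.2 p.2.1 p.2.2.1 p.2.2.2) ''
        ((I ×ˢ I ×ˢ I) ×ˢ (B ×ˢ B ×ˢ B))) :=
    ((hI.prod (hI.prod hI)).prod (hB.prod (hB.prod hB))).image (by fun_prop)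
  refine h.of_isClosed_subset (isClosed_le (by fun_prop) continuous_const) fun M hM => ?_
  have hM : inn M M ≤ R := hM
  refine ⟨((dA M, dB M, dC M), (oX M, oY M, oW M)), ?_, herm_coords M⟩
  have hR : R ≤ |R| := le_abs_self R
  simp only [inn, real_inner_self_eq_norm_sq] at hM
  have h1 := mul_self_nonneg (dA M)
  have h2 := mul_self_nonneg (dB M)
  have h3 := mul_self_nonneg (dC M)
  have h4 := sq_nonneg ‖oX M‖
  have h5 := sq_nonneg ‖oY M‖
  have h6 := sq_nonneg ‖oW M‖
  refine ⟨⟨?_, ?_, ?_⟩, ?_, ?_, ?_⟩ <;>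
  · refine mem_closedBall_zero_iff.mpr (Real.le_sqrt_of_sq_le ?_)
    simp only [Real.norm_eq_abs, sq_abs]
    linarith

theorem continuous_smul_h3 (g : SL3O) : Continuous fun M : h3 => g • M :=
  LinearMap.continuous_of_finiteDimensional (g.1 : h3 →ₗ[ℝ] h3)

/-- Elements fixing `I` preserve the trace form, so they lie in a product of compact balls inside
the space of all maps. The defining conditions are closed for pointwise convergence, and Tychonoff
applies; the orbit is the image under evaluation at `M`. -/
theorem isCompact_orbit (M : h3) : IsCompact {N | ∃ k : SL3O, k • idMat = idMat ∧ k • M = N} := by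
  let S : Set (h3 → h3) := (⋂ M, ⋂ N, {f | f (M + N) = f M + f N}) ∩
    (⋂ r : ℝ, ⋂ M, {f | f (r • M) = r • f M}) ∩ (⋂ M, {f | det (f M) = det M}) ∩
    {f | f idMat = idMat}
  have hS : IsClosed S := by
    refine ((IsClosed.inter ?_ ?_).inter ?_).inter ?_
    · exact isClosed_iInter fun M => isClosed_iInter fun N =>
        isClosed_eq (by fun_prop) (by fun_prop)
    · exact isClosed_iInter fun r => isClosed_iInter fun M =>
        isClosed_eq (by fun_prop) (by fun_prop)
    · exact isClosed_iInter fun M =>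
        isClosed_eq (continuous_det.comp (continuous_apply M)) continuous_const
    · exact isClosed_eq (by fun_prop) continuous_const
  have hB : IsCompact (Set.univ.pi fun N : h3 => {P : h3 | inn P P ≤ inn N N}) :=
    isCompact_univ_pi fun N => isCompact_inn_le _
  convert (hB.inter_right hS).image (continuous_apply M) using 1
  ext N
  constructor
  · rintro ⟨k, hk, rfl⟩
    refine ⟨fun P => k • P, ⟨fun P _ => (inn_smul hk P P).le, ?_⟩, rfl⟩
    refine ⟨⟨⟨?_, ?_⟩, ?_⟩, hk⟩
    · exact Set.mem_iInter₂.mpr (SL3O.smul_add' k)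
    · exact Set.mem_iInter₂.mpr (SL3O.smul_smul' k)
    · exact Set.mem_iInter.mpr (det_smul_eq k)
  · rintro ⟨f, ⟨-, ⟨⟨h1, h2⟩, h3⟩, h4⟩, rfl⟩
    replace h1 := fun M N => Set.mem_iInter.mp (Set.mem_iInter.mp h1 M) N
    replace h2 := fun r M => Set.mem_iInter.mp (Set.mem_iInter.mp h2 r) M
    replace h3 := fun M => Set.mem_iInter.mp h3 M
    exact ⟨SL3O.ofLinear ⟨⟨f, h1⟩, h2⟩ h3, h4, rfl⟩

/-! ### Diagonalization -/

theorem transvection_herm {u : Octonion} (hu : ‖u‖ = 1) {r a b c : ℝ} (ξ : ℝ) {x y w : Octonion}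
    (hx : x = ξ • u) : transvection (r • u) • herm a b c x y w =
      herm a (b + 2 * r * ξ + r ^ 2 * c) c ((ξ + r * c) • u) y (w + r • star (u * y)) := by
  have hu' : inner ℝ u u = 1 := by rw [real_inner_self_eq_norm_sq, hu, one_pow]
  rw [transvection_smul, hx]
  apply h3_ext <;> simp [inner_smul_left, inner_smul_right, norm_smul, hu, smul_mul_assoc]
  · ring
  · module

theorem flip_herm (a b c : ℝ) (x y w : Octonion) :
    flip • herm a b c x y w = herm a c b (star x) (star w) (star y) := by
  simp [flip_smul]

/-- A plane rotation is a product of three shears, with parameters `-t`, `s`, `-t` where `t` is the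
tangent of the half angle. The middle shear is of the opposite type, obtained by conjugating with
`flip`. The unit octonion `u` makes the entry `12` play the role of a real number. -/
theorem exists_rotation {u : Octonion} (hu : ‖u‖ = 1) {c s : ℝ} (h : c ^ 2 + s ^ 2 = 1)
    (hc : 0 < c) : ∃ k : SL3O, k • idMat = idMat ∧ ∀ (M : h3) (ξ : ℝ), oX M = ξ • u →
      dA (k • M) = dA M ∧ dB (k • M) = c ^ 2 * dB M - 2 * s * c * ξ + s ^ 2 * dC M ∧
      dC (k • M) = c ^ 2 * dC M + 2 * s * c * ξ + s ^ 2 * dB M := by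
  obtain ⟨t, ht⟩ : ∃ t, t * (1 + c) = s := ⟨s / (1 + c), by field_simp⟩
  have hts : t * s = 1 - c := by
    have : (1 + c) * (t * s - (1 - c)) = 0 := by linear_combination s * ht + h
    rcases mul_eq_zero.mp this with h0 | h0 <;> linarith
  have hq : s + t ^ 2 * s - 2 * t = 0 := by linear_combination t * hts - ht
  have hu2 : ‖star u‖ = 1 := by rw [Octonion.norm_star, hu]
  obtain ⟨k, hkdef⟩ : ∃ k, k = transvection (-t • u) * flip * transvection (s • star u) * flip *
    transvection (-t • u) := ⟨_, rfl⟩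
  have key (a b c ξ : ℝ) (y w : Octonion) : ∃ y' w', k • herm a b c (ξ • u) y w =
      transvection (-t • u) • herm a (b + 2 * (-t) * ξ + (-t) ^ 2 * c)
        (c + 2 * s * (ξ + -t * c) + s ^ 2 * (b + 2 * (-t) * ξ + (-t) ^ 2 * c))
        ((ξ + -t * c + s * (b + 2 * (-t) * ξ + (-t) ^ 2 * c)) • u) y' w' ∧
      (y = 0 → w = 0 → y' = 0 ∧ w' = 0) := by
    refine ⟨star (star y + s • star (star u * star (w + -t • star (u * y)))),
      star (star (w + -t • star (u * y))), ?_, ?_⟩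
    · simp only [hkdef, mul_smul]
      rw [transvection_herm hu ξ rfl, flip_herm,
        transvection_herm hu2 (ξ + -t * c) (by rw [star_smul, star_trivial]), flip_herm, star_smul,
        star_star, star_trivial]
    · rintro rfl rfl
      simp
  have hk : k • idMat = idMat := by
    obtain ⟨y, w, h1, h2⟩ := key 1 1 1 0 0 0
    obtain ⟨rfl, rfl⟩ := h2 rfl rfl
    rw [zero_smul] at h1
    rw [idMat_eq, h1, transvection_herm hu _ rfl]
    apply h3_ext <;> simp only [dA_herm, dB_herm, dC_herm, oX_herm, oY_herm, oW_herm]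
    · linear_combination (t ^ 2 * s - 2 * t) * hq
    · linear_combination s * hq
    · rw [smul_eq_zero]
      left
      linear_combination (1 - t * s) * hq
    · simp
  refine ⟨k, hk, fun M ξ hM => ?_⟩
  obtain ⟨y, w, h1, -⟩ := key (dA M) (dB M) (dC M) ξ (oY M) (oW M)
  rw [← hM, herm_coords] at h1
  have hA : dA (k • M) = dA M := by rw [h1, transvection_smul, dA_herm, dA_herm]
  have hC : dC (k • M) = c ^ 2 * dC M + 2 * s * c * ξ + s ^ 2 * dB M := by
    rw [h1, transvection_smul, dC_herm, dC_herm]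
    linear_combination (-(dC M) * (1 - t * s + c) - 2 * s * ξ) * hts
  refine ⟨hA, ?_, hC⟩
  -- The remaining diagonal entry follows from the invariance of the trace.
  have hT := tr_smul hk M
  rw [tr_apply, tr_apply, hA, hC] at hT
  linear_combination hT - (dB M + dC M) * h

/-- Jacobi's rotation, diagonalizing the lower 2 × 2 block. It keeps the sum of the two diagonal
entries and replaces their difference `δ` by the eigenvalue gap `r`, with `r² = δ² + 4ξ²`. -/
theorem exists_rotation_lt {M : h3} (hM : oX M ≠ 0) : ∃ k : SL3O, k • idMat = idMat ∧
    dA M ^ 2 + dB M ^ 2 + dC M ^ 2 <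
      dA (k • M) ^ 2 + dB (k • M) ^ 2 + dC (k • M) ^ 2 := by
  set ξ := ‖oX M‖ with hξ
  have hξ0 : 0 < ξ := norm_pos_iff.mpr hM
  set δ := dB M - dC M with hδ
  set r := √(δ ^ 2 + 4 * ξ ^ 2) with hr
  have hr2 : r ^ 2 = δ ^ 2 + 4 * ξ ^ 2 := Real.sq_sqrt (by positivity)
  have hr0 : 0 < r := Real.sqrt_pos.mpr (by positivity)
  have hrδ : 0 < r + δ := by
    have : |δ| < r := by
      rw [← abs_of_pos hr0]
      exact sq_lt_sq.mp (by nlinarith)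
    linarith [neg_abs_le δ]
  set c := √((r + δ) / (2 * r)) with hc
  have hc2 : c ^ 2 = (r + δ) / (2 * r) := Real.sq_sqrt (by positivity)
  have hc0 : 0 < c := Real.sqrt_pos.mpr (by positivity)
  obtain ⟨s, hs⟩ : ∃ s, s * (r * c) = -ξ := ⟨-ξ / (r * c), by field_simp⟩
  have hc2' : 2 * r * c ^ 2 = r + δ := by rw [hc2]; field_simp
  have hs2 : 2 * r * s ^ 2 = r - δ := by
    have h1 : s ^ 2 * r ^ 2 * c ^ 2 = ξ ^ 2 := by linear_combination (s * (r * c) - ξ) * hs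
    have h2 : (r + δ) * (2 * r * s ^ 2 - (r - δ)) = 0 := by
      rw [← hc2']
      linear_combination 4 * h1 + (δ - r) * hc2' - hr2
    rcases mul_eq_zero.mp h2 with h3 | h3 <;> linarith
  have hcs : c ^ 2 + s ^ 2 = 1 := by
    have : 2 * r * (c ^ 2 + s ^ 2 - 1) = 0 := by linear_combination hc2' + hs2
    rcases mul_eq_zero.mp this with h3 | h3 <;> linarith
  obtain ⟨k, hk, h⟩ := exists_rotation (u := ξ⁻¹ • oX M)
    (by rw [norm_smul, norm_inv, norm_norm, inv_mul_cancel₀ hξ0.ne']) hcs hc0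
  obtain ⟨hA, hB, hC⟩ := h M ξ (by rw [smul_smul, mul_inv_cancel₀ hξ0.ne', one_smul])
  refine ⟨k, hk, ?_⟩
  rw [hA]
  have h1 : dB (k • M) + dC (k • M) = dB M + dC M := by
    rw [hB, hC]
    linear_combination (dB M + dC M) * hcs
  have h2 : dB (k • M) - dC (k • M) = r := by
    have : r * (dB (k • M) - dC (k • M)) = r * r := by
      rw [hB, hC]
      linear_combination δ / 2 * hc2' - δ / 2 * hs2 - 4 * ξ * hs - hr2
    exact mul_left_cancel₀ hr0.ne' this
  have h3 : dB (k • M) ^ 2 + dC (k • M) ^ 2 = ((dB M + dC M) ^ 2 + r ^ 2) / 2 := by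
    rw [← h1, ← h2]
    ring
  have h4 : dB M ^ 2 + dC M ^ 2 = ((dB M + dC M) ^ 2 + δ ^ 2) / 2 := by rw [hδ]; ring
  nlinarith

/-- Every Hermitian matrix is diagonalized by an element of `SU₃(𝕆)`. -/
theorem exists_smul_eq_diagonal (M : h3) : ∃ k : SL3O, k • idMat = idMat ∧
    ∃ a b c, k • M = herm a b c 0 0 0 := by
  obtain ⟨N, ⟨k, hk, rfl⟩, hmax⟩ := (isCompact_orbit M).exists_isMaxOn
    ⟨M, 1, one_smul _ _, one_smul _ _⟩
    (f := fun N => dA N ^ 2 + dB N ^ 2 + dC N ^ 2) (by fun_prop)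
  -- Stated for other maximizers on the orbit too, so that cyclic permutations bring the two other
  -- off-diagonal entries into position `12`.
  have hX : ∀ g : SL3O, g • idMat = idMat → (dA (g • k • M) ^ 2 + dB (g • k • M) ^ 2 +
      dC (g • k • M) ^ 2 = dA (k • M) ^ 2 + dB (k • M) ^ 2 + dC (k • M) ^ 2) →
      oX (g • k • M) = 0 := by
    intro g hg h
    by_contra h0
    obtain ⟨k', hk', hlt⟩ := exists_rotation_lt h0
    rw [h] at hlt
    have hle := hmax (show k' • g • k • M ∈ _ from
      ⟨k' * g * k, by rw [mul_smul, mul_smul, hk, hg, hk'], by simp only [mul_smul]⟩)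
    exact hlt.not_ge hle
  have h0 : oX (k • M) = 0 := by simpa using hX 1 (one_smul _ _) (by simp)
  have h1 : oY (k • M) = 0 := by
    simpa only [cyclic_smul, oX_herm] using hX cyclic cyclic_smul_idMat
      (by simp only [cyclic_smul, dA_herm, dB_herm, dC_herm]; ring)
  have h2 : oW (k • M) = 0 := by
    simpa only [mul_smul, cyclic_smul, oX_herm, oY_herm] using hX (cyclic * cyclic)
      (by rw [mul_smul, cyclic_smul_idMat, cyclic_smul_idMat])
      (by simp only [mul_smul, cyclic_smul, dA_herm, dB_herm, dC_herm]; ring)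
  refine ⟨k, hk, dA (k • M), dB (k • M), dC (k • M), ?_⟩
  conv_lhs => rw [← herm_coords (k • M)]
  rw [h0, h1, h2]

/-! ### Positivity -/

/-- A Hermitian matrix is positive semidefinite if its principal minors are nonnegative. -/
structure Psd (M : h3) : Prop where
  a : 0 ≤ dA M
  b : 0 ≤ dB M
  c : 0 ≤ dC M
  bc : 0 ≤ dB M * dC M - ‖oX M‖ ^ 2
  ca : 0 ≤ dC M * dA M - ‖oY M‖ ^ 2
  ab : 0 ≤ dA M * dB M - ‖oW M‖ ^ 2
  det : 0 ≤ det M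

theorem psd_diagonal_iff {a b c : ℝ} : Psd (herm a b c 0 0 0) ↔ 0 ≤ a ∧ 0 ≤ b ∧ 0 ≤ c := by
  refine ⟨fun h => ⟨by simpa using h.a, by simpa using h.b, by simpa using h.c⟩, ?_⟩
  rintro ⟨ha, hb, hc⟩
  constructor <;> simp [det_herm] <;> positivity

theorem det_smul_idMat_sub_diagonal (t a b c : ℝ) :
    det (t • idMat - herm a b c 0 0 0) = (t - a) * (t - b) * (t - c) := by
  rw [det_smul_idMat_sub]
  simp [tr_apply, sigma, det_herm]
  ring

theorem inn_diagonal_nonneg {a b c : ℝ} (ha : 0 ≤ a) (hb : 0 ≤ b) (hc : 0 ≤ c) {F : h3}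
    (hF : sqr F = F) : 0 ≤ inn (herm a b c 0 0 0) F := by
  have h : inn (herm a b c 0 0 0) F = a * dA (sqr F) + b * dB (sqr F) + c * dC (sqr F) := by
    rw [hF]
    simp [inn]
  rw [h, sqr_eq, dA_herm, dB_herm, dC_herm]
  positivity

/-- A diagonal entry is the pairing with a diagonal idempotent. Moving `k` to the other side
preserves idempotents, and the diagonal of an idempotent, being that of its square, is a sum of
squares. -/
theorem diag_smul_diagonal_nonneg {k : SL3O} (hk : k • idMat = idMat) {a b c : ℝ} (ha : 0 ≤ a)
    (hb : 0 ≤ b) (hc : 0 ≤ c) : 0 ≤ dA (k • herm a b c 0 0 0) ∧ 0 ≤ dB (k • herm a b c 0 0 0) ∧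
      0 ≤ dC (k • herm a b c 0 0 0) := by
  have key (F : h3) (hF : sqr F = F) : 0 ≤ inn (k • herm a b c 0 0 0) F := by
    rw [← smul_inv_smul k F, inn_smul hk]
    refine inn_diagonal_nonneg ha hb hc ?_
    rw [sqr_smul (inv_smul_idMat hk), hF]
  refine ⟨?_, ?_, ?_⟩
  · simpa [inn] using key (herm 1 0 0 0 0 0) (by rw [sqr_eq]; simp)
  · simpa [inn] using key (herm 0 1 0 0 0 0) (by rw [sqr_eq]; simp)
  · simpa [inn] using key (herm 0 0 1 0 0 0) (by rw [sqr_eq]; simp)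

theorem sharp_diagonal (a b c : ℝ) :
    sharp (herm a b c 0 0 0) = herm (b * c) (c * a) (a * b) 0 0 0 := by
  simp [sharp]

theorem sqr_diagonal (a b c : ℝ) :
    sqr (herm a b c 0 0 0) = herm (a ^ 2) (b ^ 2) (c ^ 2) 0 0 0 := by
  rw [sqr_eq]
  simp

/-- The 2 × 2 minors are the diagonal entries of the adjugate, which is again `k` applied to a
nonnegative diagonal matrix. -/
theorem Psd.smul_diagonal {k : SL3O} (hk : k • idMat = idMat) {a b c : ℝ} (ha : 0 ≤ a)
    (hb : 0 ≤ b) (hc : 0 ≤ c) : Psd (k • herm a b c 0 0 0) := by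
  obtain ⟨h1, h2, h3⟩ := diag_smul_diagonal_nonneg hk ha hb hc
  obtain ⟨h4, h5, h6⟩ := diag_smul_diagonal_nonneg hk (mul_nonneg hb hc) (mul_nonneg hc ha)
    (mul_nonneg ha hb)
  rw [← sharp_diagonal, ← sharp_smul hk] at h4 h5 h6
  simp only [sharp, dA_herm, dB_herm, dC_herm] at h4 h5 h6
  refine ⟨h1, h2, h3, h4, h5, h6, ?_⟩
  rw [det_smul_eq]
  exact (psd_diagonal_iff.mpr ⟨ha, hb, hc⟩).det

theorem psd_iff {M : h3} : Psd M ↔ ∀ t : ℝ, det (t • idMat - M) = 0 → 0 ≤ t := by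
  constructor
  -- For negative `t` every term of the characteristic polynomial is nonpositive and the cubic one
  -- is negative.
  · intro h t ht
    by_contra! hlt
    rw [det_smul_idMat_sub, tr_apply, sigma] at ht
    have h1 := h.det
    have h2 : 0 ≤ (dA M + dB M + dC M) * t ^ 2 :=
      mul_nonneg (by linarith [h.a, h.b, h.c]) (sq_nonneg t)
    have h3 := mul_nonneg (add_nonneg (add_nonneg h.ab h.bc) h.ca) (neg_pos.mpr hlt).le
    have h4 : t ^ 3 < 0 := Odd.pow_neg (by decide) hlt
    nlinarith
  · intro h
    obtain ⟨k, hk, a, b, c, hM⟩ := exists_smul_eq_diagonal M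
    have hdet (t : ℝ) : det (t • idMat - M) = (t - a) * (t - b) * (t - c) := by
      rw [← det_smul_idMat_sub_smul hk, hM, det_smul_idMat_sub_diagonal]
    rw [← inv_smul_smul k M, hM]
    exact Psd.smul_diagonal (inv_smul_idMat hk) (h a (by rw [hdet]; ring))
      (h b (by rw [hdet]; ring)) (h c (by rw [hdet]; ring))

theorem isPosDef_iff {M : h3} : IsPosDef M ↔ Psd M ∧ 0 < det M := by
  have h0 : det ((0 : ℝ) • idMat - M) = -det M := by rw [det_smul_idMat_sub]; ring
  constructor
  · intro h
    have hM : Psd M := psd_iff.mpr fun t ht => (h t ht).le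
    refine ⟨hM, hM.det.lt_of_ne' fun h1 => ?_⟩
    exact (h 0 (by rw [h0, h1, neg_zero])).ne rfl
  · rintro ⟨h, h1⟩ t ht
    refine (psd_iff.mp h t ht).lt_of_ne' ?_
    rintro rfl
    rw [h0] at ht
    linarith

theorem psd_smul_iff {k : SL3O} (hk : k • idMat = idMat) {M : h3} : Psd (k • M) ↔ Psd M := by
  simp only [psd_iff, det_smul_idMat_sub_smul hk]

/-- The determinant is hyperbolic with respect to every `g • I`. -/
theorem exists_roots (g : SL3O) (N : h3) : ∃ p q r : ℝ, ∀ t : ℝ,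
    det (t • (g • idMat) - N) = (t - p) * (t - q) * (t - r) := by
  obtain ⟨k, hk, p, q, r, h⟩ := exists_smul_eq_diagonal (g⁻¹ • N)
  refine ⟨p, q, r, fun t => ?_⟩
  rw [← det_smul_idMat_sub_diagonal, ← h, det_smul_idMat_sub_smul hk,
    ← det_smul_eq g (t • idMat - g⁻¹ • N),
    SL3O.smul_sub', SL3O.smul_smul', smul_inv_smul]

/-- The roots have sum zero, so `c` is half the sum of their squares. -/
theorem nonneg_of_forall_eq_cubic {c p q r : ℝ}
    (h : ∀ t : ℝ, t ^ 3 - c * t = (t - p) * (t - q) * (t - r)) : 0 ≤ c := by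
  have h1 : p + q + r = 0 := by linarith [h 0, h 1, h (-1)]
  have h2 : p * q + q * r + r * p = -c := by linarith [h 0, h 1, h (-1)]
  nlinarith [sq_nonneg p, sq_nonneg q, sq_nonneg r]

/-- Diagonalize `g • I` to `D = diag(a, b, c)` with `abc = 1`. For `N` with a single off-diagonal
unit, `det (t D - N)` is `t³ - a t`, or the same with `b` or `c`. Its roots are all real by
`exists_roots`, so each diagonal entry is nonnegative. -/
theorem isPosDef_smul_idMat (g : SL3O) : IsPosDef (g • idMat) := by
  have hI : det idMat = 1 := by simp [idMat_eq, det_herm]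
  rw [isPosDef_iff, det_smul_eq, hI]
  refine ⟨?_, one_pos⟩
  obtain ⟨k, hk, a, b, c, h⟩ := exists_smul_eq_diagonal (g • idMat)
  rw [← psd_smul_iff hk, h, psd_diagonal_iff]
  have h1 : a * b * c = 1 := by
    have := congrArg det h
    rw [det_smul_eq, det_smul_eq, hI, det_herm] at this
    simpa using this.symm
  have key : ∀ N, ∃ p q r : ℝ, ∀ t : ℝ,
      det (t • herm a b c 0 0 0 - N) = (t - p) * (t - q) * (t - r) := by
    intro N
    rw [← h, ← mul_smul]
    exact exists_roots (k * g) N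
  refine ⟨?_, ?_, ?_⟩
  · obtain ⟨p, q, r, hN⟩ := key (herm 0 0 0 1 0 0)
    refine nonneg_of_forall_eq_cubic (p := p) (q := q) (r := r) fun t => ?_
    rw [← hN]
    simp [det_eq]
    linear_combination (-t ^ 3) * h1
  · obtain ⟨p, q, r, hN⟩ := key (herm 0 0 0 0 1 0)
    refine nonneg_of_forall_eq_cubic (p := p) (q := q) (r := r) fun t => ?_
    rw [← hN]
    simp [det_eq]
    linear_combination (-t ^ 3) * h1
  · obtain ⟨p, q, r, hN⟩ := key (herm 0 0 0 0 0 1)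
    refine nonneg_of_forall_eq_cubic (p := p) (q := q) (r := r) fun t => ?_
    rw [← hN]
    simp [det_eq]
    linear_combination (-t ^ 3) * h1

/-! ### The square -/

theorem det_sqr (M : h3) : det (sqr M) = det M ^ 2 := by
  obtain ⟨k, hk, a, b, c, h⟩ := exists_smul_eq_diagonal M
  rw [← det_smul_eq k, ← sqr_smul hk, ← det_smul_eq k M, h, sqr_diagonal, det_herm, det_herm]
  simp
  ring

theorem psd_sqr (M : h3) : Psd (sqr M) := by
  obtain ⟨k, hk, a, b, c, h⟩ := exists_smul_eq_diagonal M
  rw [← psd_smul_iff hk, ← sqr_smul hk, h, sqr_diagonal, psd_diagonal_iff]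
  exact ⟨sq_nonneg _, sq_nonneg _, sq_nonneg _⟩

theorem Psd.exists_sqr_eq {P : h3} (hP : Psd P) : ∃ M, Psd M ∧ sqr M = P := by
  obtain ⟨k, hk, a, b, c, h⟩ := exists_smul_eq_diagonal P
  rw [← psd_smul_iff hk, h, psd_diagonal_iff] at hP
  obtain ⟨ha, hb, hc⟩ := hP
  have hk' := inv_smul_idMat hk
  refine ⟨k⁻¹ • herm √a √b √c 0 0 0,
    Psd.smul_diagonal hk' (Real.sqrt_nonneg _) (Real.sqrt_nonneg _) (Real.sqrt_nonneg _), ?_⟩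
  rw [sqr_smul hk', sqr_diagonal, Real.sq_sqrt ha, Real.sq_sqrt hb, Real.sq_sqrt hc, ← h,
    inv_smul_smul]

theorem eq_zero_of_smul_eq_neg {b c b' c' : ℝ} {x p : Octonion} (hb : 0 ≤ b) (hc : 0 ≤ c)
    (hb' : 0 ≤ b') (hc' : 0 ≤ c') (hx : 0 ≤ b * c - ‖x‖ ^ 2)
    (h : p + (b + c) • x = p + (b' + c') • (-x)) : x = 0 := by
  have h1 : (b + c + (b' + c')) • x = 0 := by
    have h2 := add_left_cancel h
    rw [add_smul, h2]
    module
  rcases smul_eq_zero.mp h1 with h2 | h2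
  · have hb0 : b = 0 := by linarith
    rw [hb0] at hx
    have : ‖x‖ ^ 2 = 0 := le_antisymm (by linarith) (sq_nonneg _)
    simpa using this
  · exact h2

/-- A positive semidefinite matrix is determined by its square. -/
theorem Psd.eq_of_sqr_eq {M N : h3} (hM : Psd M) (hN : Psd N) (h : sqr M = sqr N) : M = N := by
  -- Once the sum is diagonal, the off-diagonal entries of the two matrices are opposite. The
  -- quadratic parts of the off-diagonal entries of the squares then agree, and the linear parts
  -- force these entries to vanish.
  obtain ⟨k, hk, a, b, c, hs⟩ := exists_smul_eq_diagonal (M + N)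
  refine MulAction.injective k ?_
  change k • M = k • N
  rw [← psd_smul_iff hk] at hM hN
  rw [SL3O.smul_add'] at hs
  have h := congrArg (k • ·) h
  simp only [← sqr_smul hk] at h
  generalize k • M = M at *
  generalize k • N = N at *
  have hX : oX N = -oX M := by
    have := congrArg oX hs
    rw [map_add, oX_herm] at this
    exact eq_neg_of_add_eq_zero_right this
  have hY : oY N = -oY M := by
    have := congrArg oY hs
    rw [map_add, oY_herm] at this
    exact eq_neg_of_add_eq_zero_right this
  have hW : oW N = -oW M := by
    have := congrArg oW hs
    rw [map_add, oW_herm] at this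
    exact eq_neg_of_add_eq_zero_right this
  rw [sqr_eq, sqr_eq] at h
  have hX0 : oX M = 0 := by
    have h1 := congrArg oX h
    simp only [oX_herm, hX, hY, hW, neg_mul_neg] at h1
    exact eq_zero_of_smul_eq_neg hM.b hM.c hN.b hN.c hM.bc h1
  have hY0 : oY M = 0 := by
    have h1 := congrArg oY h
    simp only [oY_herm, hX, hY, hW, neg_mul_neg] at h1
    exact eq_zero_of_smul_eq_neg hM.c hM.a hN.c hN.a hM.ca h1
  have hW0 : oW M = 0 := by
    have h1 := congrArg oW h
    simp only [oW_herm, hX, hY, hW, neg_mul_neg] at h1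
    exact eq_zero_of_smul_eq_neg hM.a hM.b hN.a hN.b hM.ab h1
  have hA := congrArg dA h
  have hB := congrArg dB h
  have hC := congrArg dC h
  simp only [dA_herm, dB_herm, dC_herm, hX, hY, hW, hX0, hY0, hW0, norm_neg, norm_zero] at hA hB hC
  apply h3_ext
  · exact (sq_eq_sq₀ hM.a hN.a).mp (by linarith)
  · exact (sq_eq_sq₀ hM.b hN.b).mp (by linarith)
  · exact (sq_eq_sq₀ hM.c hN.c).mp (by linarith)
  · rw [hX, hX0, neg_zero]
  · rw [hY, hY0, neg_zero]
  · rw [hW, hW0, neg_zero]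

theorem Psd.smul {M : h3} (hM : Psd M) {r : ℝ} (hr : 0 ≤ r) : Psd (r • M) := by
  have h (a b : ℝ) (x : Octonion) (h1 : 0 ≤ a * b - ‖x‖ ^ 2) :
      0 ≤ (r * a) * (r * b) - ‖r • x‖ ^ 2 := by
    rw [norm_smul, mul_pow, Real.norm_eq_abs, sq_abs]
    have := mul_nonneg (sq_nonneg r) h1
    linarith
  exact ⟨mul_nonneg hr hM.a, mul_nonneg hr hM.b, mul_nonneg hr hM.c, h _ _ _ hM.bc, h _ _ _ hM.ca,
    h _ _ _ hM.ab, by rw [det_smul]; exact mul_nonneg (pow_nonneg hr 3) hM.det⟩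

theorem Psd.add_smul_idMat {M : h3} (hM : Psd M) {r : ℝ} (hr : 0 < r) :
    Psd (r • idMat + M) ∧ 0 < OctonionicSatake.det (r • idMat + M) := by
  have h (a b : ℝ) (ha : 0 ≤ a) (hb : 0 ≤ b) (x : Octonion) (h1 : 0 ≤ a * b - ‖x‖ ^ 2) :
      0 ≤ (r + a) * (r + b) - ‖x‖ ^ 2 := by
    have : 0 ≤ r ^ 2 + r * a + r * b := by positivity
    linarith
  have hdet : 0 < OctonionicSatake.det (r • idMat + M) := by
    rw [det_smul_idMat_add, tr_apply, sigma]
    have h1 := hM.det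
    have h2 : 0 ≤ (dA M + dB M + dC M) * r ^ 2 :=
      mul_nonneg (by linarith [hM.a, hM.b, hM.c]) (sq_nonneg r)
    have h3 := mul_nonneg (add_nonneg (add_nonneg hM.ab hM.bc) hM.ca) hr.le
    have h4 : 0 < r ^ 3 := by positivity
    linarith
  refine ⟨?_, hdet⟩
  constructor
  case det => exact hdet.le
  all_goals simp only [idMat_eq, map_add, map_smul, dA_herm, dB_herm, dC_herm, oX_herm, oY_herm,
    oW_herm, smul_zero, zero_add, smul_eq_mul, mul_one]
  · linarith [hM.a]
  · linarith [hM.b]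
  · linarith [hM.c]
  · exact h _ _ hM.b hM.c _ hM.bc
  · exact h _ _ hM.c hM.a _ hM.ca
  · exact h _ _ hM.a hM.b _ hM.ab

theorem isClosed_psd : IsClosed {M : h3 | Psd M} := by
  have h (f : h3 → ℝ) (hf : Continuous f) : IsClosed {M | 0 ≤ f M} := isClosed_le continuous_const hf
  have : {M : h3 | Psd M} = {M | 0 ≤ dA M} ∩ {M | 0 ≤ dB M} ∩ {M | 0 ≤ dC M} ∩
      {M | 0 ≤ dB M * dC M - ‖oX M‖ ^ 2} ∩ {M | 0 ≤ dC M * dA M - ‖oY M‖ ^ 2} ∩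
      {M | 0 ≤ dA M * dB M - ‖oW M‖ ^ 2} ∩ {M | 0 ≤ det M} := by
    ext M
    exact ⟨fun ⟨h1, h2, h3, h4, h5, h6, h7⟩ => ⟨⟨⟨⟨⟨⟨h1, h2⟩, h3⟩, h4⟩, h5⟩, h6⟩, h7⟩,
      fun ⟨⟨⟨⟨⟨⟨h1, h2⟩, h3⟩, h4⟩, h5⟩, h6⟩, h7⟩ => ⟨h1, h2, h3, h4, h5, h6, h7⟩⟩
  rw [this]
  exact ((((((h _ (by fun_prop)).inter (h _ (by fun_prop))).inter (h _ (by fun_prop))).inter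
    (h _ (by fun_prop))).inter (h _ (by fun_prop))).inter (h _ (by fun_prop))).inter
    (h _ (by fun_prop))

/-! ### Cholesky decomposition -/

/-- One entry of the identity saying that the adjugate of the adjugate is `det M • M`. -/
theorem mul_det_eq (M : h3) : dC M * det M = (dB M * dC M - ‖oX M‖ ^ 2) *
    (dC M * dA M - ‖oY M‖ ^ 2) - ‖star (oX M * oY M) - dC M • oW M‖ ^ 2 := by
  rw [norm_sub_sq_real, inner_smul_right, Octonion.norm_star, Octonion.norm_mul, inner_star_left,
    ← re_mul, det_eq, norm_smul]
  simp only [mul_pow, Real.norm_eq_abs, sq_abs]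
  ring

/-- The trailing principal minors are positive. -/
structure TrailingPos (M : h3) : Prop where
  c : 0 < dC M
  bc : 0 < dB M * dC M - ‖oX M‖ ^ 2
  det : 0 < det M

theorem Psd.trailingPos {M : h3} (h : Psd M) (hd : 0 < OctonionicSatake.det M) :
    TrailingPos M := by
  have hc : 0 < dC M := by
    refine h.c.lt_of_ne' fun h0 => ?_
    have h1 := h.bc
    have h2 := h.ca
    rw [h0] at h1 h2
    have hx : ‖oX M‖ = 0 := by
      rw [← pow_eq_zero_iff two_ne_zero]
      exact le_antisymm (by linarith) (sq_nonneg _)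
    have hy : ‖oY M‖ = 0 := by
      rw [← pow_eq_zero_iff two_ne_zero]
      exact le_antisymm (by linarith) (sq_nonneg _)
    rw [det_eq, hx, hy, norm_eq_zero.mp hx, h0] at hd
    simp at hd
  refine ⟨hc, h.bc.lt_of_ne' fun h0 => ?_, hd⟩
  have h1 := mul_det_eq M
  rw [h0] at h1
  have := mul_pos hc hd
  nlinarith [sq_nonneg ‖star (oX M * oY M) - dC M • oW M‖]

/-- One step of the Cholesky reduction: eliminate the entry `12`, then permute cyclically. -/
def cholStep (M : h3) : h3 :=
  (cyclic * cyclic) • transvection (-((dC M)⁻¹ • oX M)) • M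

theorem cyclic_mul_smul (M : h3) : cyclic • (cyclic * cyclic) • M = M := by
  simp [mul_smul, cyclic_smul, herm_coords]

theorem transvection_smul_neg (a : Octonion) (M : h3) :
    transvection a • transvection (-a) • M = M := by
  apply h3_ext <;> simp [transvection_smul, inner_add_right, inner_smul_right, -star_mul]
  ring

theorem eq_smul_cholStep (M : h3) :
    transvection ((dC M)⁻¹ • oX M) • cyclic • cholStep M = M := by
  rw [cholStep, cyclic_mul_smul, transvection_smul_neg]

theorem cholStep_eq {M : h3} (hM : dC M ≠ 0) : cholStep M =
    herm (dC M) (dA M) (dB M - ‖oX M‖ ^ 2 / dC M)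
      (oW M - star (((dC M)⁻¹ • oX M) * oY M)) 0 (oY M) := by
  simp only [cholStep, transvection_smul, mul_smul, cyclic_smul]
  apply h3_ext <;> simp [inner_neg_left, inner_smul_left, norm_smul, mul_pow, -star_mul,
    smul_smul, hM]
  · field_simp
    ring
  · abel

theorem TrailingPos.cholStep {M : h3} (h : TrailingPos M) : TrailingPos (cholStep M) := by
  have hdet : OctonionicSatake.det (OctonionicSatake.cholStep M) = OctonionicSatake.det M := by
    rw [OctonionicSatake.cholStep, det_smul_eq, det_smul_eq]
  have hb : 0 < dB M - ‖oX M‖ ^ 2 / dC M := by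
    have : dB M - ‖oX M‖ ^ 2 / dC M = (dB M * dC M - ‖oX M‖ ^ 2) / dC M := by
      field_simp [h.c.ne']
    rw [this]
    exact div_pos h.bc h.c
  have hp : 0 < OctonionicSatake.det (OctonionicSatake.cholStep M) := hdet ▸ h.det
  refine ⟨?_, ?_, hp⟩
  · rw [cholStep_eq h.c.ne']
    simpa using hb
  · rw [cholStep_eq h.c.ne'] at hp ⊢
    rw [det_herm] at hp
    simp only [dB_herm, dC_herm, oX_herm]
    simp only [norm_zero, mul_zero, zero_mul, re_zero] at hp
    -- With the entry `20` now zero, `dC M` times the wanted minor equals the determinant plus this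
    -- nonnegative term.
    have h1 := mul_nonneg hb.le (sq_nonneg ‖oY M‖)
    refine pos_of_mul_pos_right (a := dC M) ?_ h.c.le
    linarith

/-- Each step puts a zero in position `20` and moves the old entry `20` to position `01`; three
steps clear all the off-diagonal entries. -/
theorem cholStep_three {M : h3} (h : TrailingPos M) : ∃ a b c : ℝ, 0 < a ∧ 0 < b ∧ 0 < c ∧
    cholStep (cholStep (cholStep M)) = herm a b c 0 0 0 := by
  have h1 := h.cholStep
  have h2 := h1.cholStep
  have h3 := h2.cholStep
  have hY1 : oY (cholStep M) = 0 := by rw [cholStep_eq h.c.ne', oY_herm]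
  have hY2 : oY (cholStep (cholStep M)) = 0 := by rw [cholStep_eq h1.c.ne', oY_herm]
  have hW2 : oW (cholStep (cholStep M)) = 0 := by rw [cholStep_eq h1.c.ne', oW_herm, hY1]
  have hc := h3.c
  have hbc := h3.bc
  have hd := h3.det
  rw [cholStep_eq h2.c.ne', hY2, hW2] at hc hbc hd ⊢
  simp only [mul_zero, star_zero, sub_zero] at hc hbc hd ⊢
  rw [det_herm] at hd
  simp only [dC_herm, dB_herm, oX_herm, norm_zero, mul_zero, re_zero] at hc hbc hd
  refine ⟨_, _, _, h2.c, ?_, hc, rfl⟩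
  exact pos_of_mul_pos_left (b := _) (by linarith) hc.le

/-- A real diagonal matrix acting on the identity. -/
theorem diagonal_smul_idMat {a b c : ℝ} (ha : 0 < a) (hb : 0 < b) (hc : 0 < c)
    (h : √a * √b * √c = 1) : diagonal √a √b √c h • idMat = herm a b c 0 0 0 := by
  rw [idMat_eq, diagonal_smul]
  simp [Real.sq_sqrt, ha.le, hb.le, hc.le]

namespace PosDefOne

theorem trailingPos (P : PosDefOne) : TrailingPos P.1 :=
  (isPosDef_iff.mp P.2.1).1.trailingPos (isPosDef_iff.mp P.2.1).2

/-- The diagonal part of the Cholesky decomposition. -/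
def cholDiag (P : PosDefOne) : h3 := cholStep (cholStep (cholStep P.1))

theorem cholDiag_spec (P : PosDefOne) : ∃ a b c : ℝ, 0 < a ∧ 0 < b ∧ 0 < c ∧
    P.cholDiag = herm a b c 0 0 0 ∧ √a * √b * √c = 1 := by
  obtain ⟨a, b, c, ha, hb, hc, h⟩ := cholStep_three P.trailingPos
  refine ⟨a, b, c, ha, hb, hc, h, ?_⟩
  have h1 := congrArg det h
  simp only [cholStep, det_smul_eq, P.2.2, det_herm] at h1
  rw [← Real.sqrt_mul ha.le, ← Real.sqrt_mul (mul_pos ha hb).le, Real.sqrt_eq_one]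
  simpa using h1.symm

theorem sqrt_cholDiag (P : PosDefOne) :
    √(dA P.cholDiag) * √(dB P.cholDiag) * √(dC P.cholDiag) = 1 := by
  obtain ⟨a, b, c, -, -, -, h, h1⟩ := P.cholDiag_spec
  simpa [h] using h1

/-- A continuous section of the orbit map `g ↦ g • I`. -/
def choleskySection (P : PosDefOne) : SL3O :=
  transvection ((dC P.1)⁻¹ • oX P.1) * cyclic *
  (transvection ((dC (cholStep P.1))⁻¹ • oX (cholStep P.1)) * cyclic) *
  (transvection ((dC (cholStep (cholStep P.1)))⁻¹ • oX (cholStep (cholStep P.1))) * cyclic) *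
  diagonal _ _ _ P.sqrt_cholDiag

theorem choleskySection_smul (P : PosDefOne) : P.choleskySection • idMat = P.1 := by
  have h : diagonal _ _ _ P.sqrt_cholDiag • idMat = P.cholDiag := by
    obtain ⟨a, b, c, ha, hb, hc, h, h1⟩ := P.cholDiag_spec
    have key : ∀ N (h' : √(dA N) * √(dB N) * √(dC N) = 1), N = herm a b c 0 0 0 →
        diagonal _ _ _ h' • idMat = N := by
      rintro N h' rfl
      simp only [dA_herm, dB_herm, dC_herm] at h' ⊢
      exact diagonal_smul_idMat ha hb hc h'
    exact key _ _ h
  simp only [choleskySection, mul_smul]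
  rw [h, cholDiag, eq_smul_cholStep, eq_smul_cholStep, eq_smul_cholStep]

end PosDefOne

section continuity
variable {T : Type*} [TopologicalSpace T]

theorem continuous_transvection_smul {a : T → Octonion} {f : T → h3} (ha : Continuous a)
    (hf : Continuous f) : Continuous fun t => transvection (a t) • f t := by
  simp only [transvection_smul]
  fun_prop

theorem continuous_cholStep {f : T → h3} (hf : Continuous f) (h : ∀ t, dC (f t) ≠ 0) :
    Continuous fun t => cholStep (f t) := by
  refine (continuous_smul_h3 _).comp (continuous_transvection_smul ?_ hf)
  exact (((continuous_dC.comp hf).inv₀ h).smul (continuous_oX.comp hf)).neg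

theorem continuous_factor {f F : T → h3} (hf : Continuous f) (h : ∀ t, dC (f t) ≠ 0)
    (hF : Continuous F) :
    Continuous fun t => (transvection ((dC (f t))⁻¹ • oX (f t)) * cyclic) • F t := by
  simp only [mul_smul]
  exact continuous_transvection_smul
    (((continuous_dC.comp hf).inv₀ h).smul (continuous_oX.comp hf))
    ((continuous_smul_h3 _).comp hF)

end continuity

theorem PosDefOne.continuous_choleskySection : Continuous PosDefOne.choleskySection := by
  refine continuous_induced_rng.mpr (continuous_pi fun M => ?_)
  have h0 : Continuous fun P : PosDefOne => P.1 := continuous_subtype_val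
  have hc0 : ∀ P : PosDefOne, dC P.1 ≠ 0 := fun P => P.trailingPos.c.ne'
  have hc1 : ∀ P : PosDefOne, dC (cholStep P.1) ≠ 0 := fun P => P.trailingPos.cholStep.c.ne'
  have hc2 : ∀ P : PosDefOne, dC (cholStep (cholStep P.1)) ≠ 0 :=
    fun P => P.trailingPos.cholStep.cholStep.c.ne'
  have h1 := continuous_cholStep h0 hc0
  have h2 := continuous_cholStep h1 hc1
  have h3 : Continuous PosDefOne.cholDiag := continuous_cholStep h2 hc2
  have h4 : Continuous fun P : PosDefOne => diagonal _ _ _ P.sqrt_cholDiag • M := by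
    simp only [diagonal_smul]
    fun_prop
  have h5 := continuous_factor h0 hc0 (continuous_factor h1 hc1 (continuous_factor h2 hc2 h4))
  have h6 (g₁ g₂ g₃ g₄ : SL3O) : g₁ • g₂ • g₃ • g₄ • M = (g₁ * g₂ * g₃ * g₄) • M := by
    simp only [mul_smul]
  simp only [h6] at h5
  exact h5

/-- `SL₃(𝕆) / SU₃(𝕆)` is homeomorphic to the space of positive definite matrices of
determinant 1. -/
def orbitHomeo : SymmetricSpace ≃ₜ PosDefOne where
  toFun := Quotient.lift (fun g : SL3O => (⟨g • idMat, isPosDef_smul_idMat g, by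
      rw [det_smul_eq, idMat_eq, det_herm]; simp⟩ : PosDefOne)) (by
    intro a b hab
    have h : a⁻¹ * b ∈ SU3O := QuotientGroup.leftRel_apply.mp hab
    have h1 : (a⁻¹ * b) • idMat = idMat := h
    apply Subtype.ext
    change a • idMat = b • idMat
    rw [mul_smul, inv_smul_eq_iff] at h1
    exact h1.symm)
  invFun P := (P.choleskySection : SL3O)
  left_inv := by
    intro x
    induction x using QuotientGroup.induction_on with
    | H g =>
      refine QuotientGroup.eq.mpr ?_
      change (_ * g) • idMat = idMat
      rw [mul_smul, inv_smul_eq_iff, PosDefOne.choleskySection_smul]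
      rfl
  right_inv := by
    intro P
    exact Subtype.ext P.choleskySection_smul
  continuous_toFun := by
    refine Continuous.quotient_lift (Continuous.subtype_mk ?_ _) _
    exact (continuous_apply idMat).comp continuous_induced_dom
  continuous_invFun := continuous_quotient_mk'.comp PosDefOne.continuous_choleskySection

theorem orbitHomeo_coe (g : SL3O) : (orbitHomeo (g : SymmetricSpace)).1 = g • idMat := rfl

/-! ### Quotients by scalars -/

/-- The saturation of an open set is a union of preimages under homotheties. Openness reduces
Hausdorffness to the closedness of the equivalence relation. -/
theorem RayProj.isOpenQuotientMap_mk (E : Type*) :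
    IsOpenQuotientMap (Quotient.mk (raySetoid E)) where
  surjective := Quotient.mk_surjective
  continuous := continuous_quotient_mk'
  isOpenMap := by
    intro U hU
    let σ (c : {c : ℝ≥0 // 0 < c}) (l : {l : E → ℝ≥0 // l ≠ 0}) : {l : E → ℝ≥0 // l ≠ 0} :=
      ⟨c.1 • l.1, smul_ne_zero c.2.ne' l.2⟩
    have h : Quotient.mk (raySetoid E) ⁻¹' (Quotient.mk (raySetoid E) '' U) = ⋃ c, σ c ⁻¹' U := by
      ext l
      simp only [Set.mem_preimage, Set.mem_image, Set.mem_iUnion]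
      constructor
      · rintro ⟨l', hl', h⟩
        obtain ⟨c, hc, h⟩ := Quotient.exact h.symm
        refine ⟨⟨c, hc⟩, ?_⟩
        rwa [show σ ⟨c, hc⟩ l = l' from Subtype.ext h.symm]
      · rintro ⟨c, hc⟩
        exact ⟨_, hc, (Quotient.sound (s := raySetoid E) (a := l) (b := σ c l) ⟨c.1, c.2, rfl⟩).symm⟩
    refine isOpen_coinduced.mpr ?_
    change IsOpen (Quotient.mk (raySetoid E) ⁻¹' _)
    rw [h]
    exact isOpen_iUnion fun c => hU.preimage
      (Continuous.subtype_mk (continuous_subtype_val.const_smul c.1) _)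

instance (E : Type*) : T2Space (RayProj E) := by
  refine (t2Space_iff_of_isOpenQuotientMap (RayProj.isOpenQuotientMap_mk E)).mpr ?_
  have h : {q : {l : E → ℝ≥0 // l ≠ 0} × {l : E → ℝ≥0 // l ≠ 0} |
      Quotient.mk (raySetoid E) q.1 = Quotient.mk (raySetoid E) q.2} =
      -- Proportionality is the vanishing of all 2 × 2 minors, a closed condition.
      ⋂ u, ⋂ v, {q | q.1.1 u * q.2.1 v = q.1.1 v * q.2.1 u} := by
    ext ⟨l, l'⟩
    simp only [Set.mem_iInter]
    constructor
    · intro h u v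
      obtain ⟨c, hc, h⟩ := Quotient.exact h
      change l.1 u * l'.1 v = l.1 v * l'.1 u
      rw [h]
      simp only [Pi.smul_apply, smul_eq_mul]
      ring
    · intro h
      obtain ⟨v, hv⟩ := Function.ne_iff.mp l.2
      have h (u) : l.1 u * l'.1 v = l.1 v * l'.1 u := h u v
      have hv' : l'.1 v ≠ 0 := by
        intro h0
        refine l'.2 (funext fun u => ?_)
        have := h u
        rw [h0, mul_zero] at this
        exact (mul_eq_zero.mp this.symm).resolve_left hv
      refine Quotient.sound ⟨l'.1 v / l.1 v, div_pos (pos_iff_ne_zero.mpr hv')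
        (pos_iff_ne_zero.mpr hv), funext fun u => ?_⟩
      rw [Pi.smul_apply, smul_eq_mul, div_mul_eq_mul_div, mul_comm, h, mul_div_cancel_left₀ _ hv]
  rw [h]
  refine isClosed_iInter fun u => isClosed_iInter fun v => isClosed_eq ?_ ?_
  all_goals
    have h1 (u : E) : Continuous fun q : {l : E → ℝ≥0 // l ≠ 0} × {l : E → ℝ≥0 // l ≠ 0} =>
      q.1.1 u := (continuous_apply u).comp (continuous_subtype_val.comp continuous_fst)
    have h2 (u : E) : Continuous fun q : {l : E → ℝ≥0 // l ≠ 0} × {l : E → ℝ≥0 // l ≠ 0} =>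
      q.2.1 u := (continuous_apply u).comp (continuous_subtype_val.comp continuous_snd)
  · exact (h1 u).mul (h2 v)
  · exact (h1 v).mul (h2 u)

/-- The class of a nonzero Hermitian matrix in the projective space. -/
def projMk (v : {v : h3 // v ≠ 0}) : Projectivization ℝ h3 := Projectivization.mk ℝ v.1 v.2

theorem isOpenQuotientMap_projMk : IsOpenQuotientMap projMk where
  surjective x := by
    induction x with
    | h v hv => exact ⟨⟨v, hv⟩, rfl⟩
  continuous := continuous_quotient_mk'
  isOpenMap := by
    intro U hU
    let σ (c : ℝˣ) (v : {v : h3 // v ≠ 0}) : {v : h3 // v ≠ 0} :=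
      ⟨c • v.1, smul_ne_zero c.ne_zero v.2⟩
    have h : projMk ⁻¹' (projMk '' U) = ⋃ c, σ c ⁻¹' U := by
      ext v
      simp only [Set.mem_preimage, Set.mem_image, Set.mem_iUnion]
      constructor
      · rintro ⟨w, hw, h⟩
        obtain ⟨c, h⟩ := (Projectivization.mk_eq_mk_iff ℝ _ _ w.2 v.2).mp h
        refine ⟨c, ?_⟩
        rwa [show σ c v = w from Subtype.ext h]
      · rintro ⟨c, hc⟩
        exact ⟨_, hc, (Projectivization.mk_eq_mk_iff ℝ _ _ _ v.2).mpr ⟨c, rfl⟩⟩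
    refine isOpen_coinduced.mpr ?_
    change IsOpen (projMk ⁻¹' _)
    rw [h]
    exact isOpen_iUnion fun c => hU.preimage
      (Continuous.subtype_mk (continuous_subtype_val.const_smul (c : ℝ)) _)

instance : T2Space (Projectivization ℝ h3) := by
  refine (t2Space_iff_of_isOpenQuotientMap isOpenQuotientMap_projMk).mpr ?_
  have h : {q : {v : h3 // v ≠ 0} × {v : h3 // v ≠ 0} | projMk q.1 = projMk q.2} =
      -- Proportionality is the equality case of Cauchy–Schwarz for the trace form.
      {q | inn q.1.1 q.1.1 * inn q.2.1 q.2.1 = inn q.1.1 q.2.1 ^ 2} := by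
    ext ⟨v, w⟩
    change Projectivization.mk ℝ v.1 v.2 = Projectivization.mk ℝ w.1 w.2 ↔
      inn v.1 v.1 * inn w.1 w.1 = inn v.1 w.1 ^ 2
    rw [Projectivization.mk_eq_mk_iff']
    constructor
    · rintro ⟨a, h⟩
      rw [← h]
      simp only [inn, map_smul, smul_eq_mul, inner_smul_left, inner_smul_right, conj_trivial]
      ring
    · intro h
      have hw : inn w.1 w.1 ≠ 0 := fun h => w.2 (eq_zero_of_inn_self h)
      refine ⟨inn v.1 w.1 / inn w.1 w.1, ?_⟩
      rw [← sub_eq_zero]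
      apply eq_zero_of_inn_self
      have key (a : ℝ) : inn (a • w.1 - v.1) (a • w.1 - v.1) =
          a ^ 2 * inn w.1 w.1 - 2 * a * inn v.1 w.1 + inn v.1 v.1 := by
        simp only [inn, map_sub, map_smul, smul_eq_mul, inner_sub_left, inner_sub_right,
          inner_smul_left, inner_smul_right, conj_trivial, real_inner_comm (oX v.1) (oX w.1),
          real_inner_comm (oY v.1) (oY w.1), real_inner_comm (oW v.1) (oW w.1)]
        ring
      rw [key]
      field_simp
      linear_combination h
  rw [h]
  exact isClosed_eq (by fun_prop) (by fun_prop)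

/-! ### Generalities on compactifications -/

section general
variable {G : Type*} [Group G] [TopologicalSpace G] {X K K' : Type*} [MulAction G X]
  [TopologicalSpace K] [TopologicalSpace K']

/-- Transport of an extended action along a homeomorphism. -/
def ExtendedAction.congr {i : X → K} (a : ExtendedAction G i) (F : K ≃ₜ K') :
    ExtendedAction G (F ∘ i) where
  action :=
    { smul := fun g k => F (a.action.smul g (F.symm k))
      one_smul := fun k => by
        change F (a.action.smul 1 (F.symm k)) = k
        rw [show a.action.smul 1 (F.symm k) = F.symm k from a.action.one_smul _,
          F.apply_symm_apply]
      mul_smul := fun g g' k => by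
        change F (a.action.smul (g * g') (F.symm k)) =
          F (a.action.smul g (F.symm (F (a.action.smul g' (F.symm k)))))
        rw [F.symm_apply_apply]
        exact congrArg F (a.action.mul_smul g g' _) }
  continuous_action := F.continuous.comp (a.continuous_action.comp
    (continuous_fst.prodMk (F.symm.continuous.comp continuous_snd)))
  smul_map g x := by
    change F (a.action.smul g (F.symm (F (i x)))) = F (i (g • x))
    rw [F.symm_apply_apply, a.smul_map]

theorem IsGCompactification.congr [TopologicalSpace X] {i : X → K}
    (h : IsGCompactification G i) (F : K ≃ₜ K') : IsGCompactification G (F ∘ i) where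
  compactSpace := have := h.compactSpace; F.compactSpace
  t2Space := have := h.t2Space; F.t2Space
  isEmbedding := F.isEmbedding.comp h.isEmbedding
  denseRange := F.surjective.denseRange.comp h.denseRange F.continuous
  extends_action := h.extends_action.map fun a => a.congr F

theorem GIsomorphic.of_homeomorph [T2Space K'] {i : X → K} (hi : DenseRange i) {i' : X → K'}
    (F : K ≃ₜ K') (hF : i' = F ∘ i) : GIsomorphic G i i' := by
  subst hF
  refine ⟨F, rfl, fun a a' g => congrFun (hi.equalizer ?_ ?_ (funext fun x => ?_))⟩
  · exact F.continuous.comp (a.continuous_action.comp (Continuous.prodMk_right g))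
  · exact a'.continuous_action.comp ((Continuous.prodMk_right g).comp F.continuous)
  · change F (a.action.smul g (i x)) = a'.action.smul g (F (i x))
    rw [a.smul_map]
    exact (a'.smul_map g x).symm

/-- The image of `τ` is compact, hence closed, and the image of `φ` is dense in it. This identifies
both closures with the sphere. -/
theorem exists_homeomorph_closure {S Y : Type*} [TopologicalSpace S] [CompactSpace S]
    [TopologicalSpace Y] [T2Space Y] {j : X → S} (hj : DenseRange j) {τ : S → Y}
    (hτ : Continuous τ) (hinj : Function.Injective τ) {φ : X → Y} (h : φ = τ ∘ j) :
    ∃ F : S ≃ₜ closure (Set.range φ), toClosure φ = F ∘ j := by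
  have hr : closure (Set.range φ) = Set.range τ := by
    rw [h, Set.range_comp]
    refine (closure_minimal (Set.image_subset_range _ _)
      (isCompact_range hτ).isClosed).antisymm ?_
    rw [← Set.image_univ, ← hj.closure_range]
    exact image_closure_subset_closure_image hτ
  refine ⟨((hτ.isClosedEmbedding hinj).isEmbedding.toHomeomorph).trans
    (Homeomorph.setCongr hr.symm), ?_⟩
  subst h
  rfl

/-- A continuous action on the target space restricts to the closure of the image of an
equivariant map. -/
def ExtendedAction.ofEquivariant {Y : Type*} [TopologicalSpace Y] [MulAction G Y]
    (hc : Continuous fun p : G × Y => p.1 • p.2) {φ : X → Y} (h : ∀ (g : G) x, φ (g • x) = g • φ x) :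
    ExtendedAction G (toClosure φ) where
  action :=
    { smul := fun g y => ⟨g • y.1, by
        have h1 : (g • ·) '' Set.range φ ⊆ Set.range φ := by
          rintro _ ⟨_, ⟨x, rfl⟩, rfl⟩
          exact ⟨g • x, h g x⟩
        exact closure_mono h1 (image_closure_subset_closure_image
          (hc.comp (Continuous.prodMk_right g)) (Set.mem_image_of_mem _ y.2))⟩
      one_smul := fun y => Subtype.ext (one_smul G y.1)
      mul_smul := fun g g' y => Subtype.ext (mul_smul g g' y.1) }
  continuous_action := Continuous.subtype_mk
    (hc.comp (continuous_fst.prodMk (continuous_subtype_val.comp continuous_snd))) _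
  smul_map g x := Subtype.ext (h g x).symm

end general

/-! ### The action on the projective space -/

/-- By linearity, pointwise convergence on a finite basis already gives joint continuity. -/
theorem continuous_SL3O_smul : Continuous fun p : SL3O × h3 => p.1 • p.2 := by
  let b := Module.finBasis ℝ h3
  have h : ∀ p : SL3O × h3, p.1 • p.2 = ∑ i, b.repr p.2 i • p.1 • b i := by
    intro p
    conv_lhs => rw [← b.sum_repr p.2]
    change p.1.1 _ = _
    rw [map_sum]
    exact Finset.sum_congr rfl fun i _ => map_smul p.1.1 _ _
  simp only [h]
  refine continuous_finsetSum _ fun i _ => ?_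
  exact ((LinearMap.continuous_of_finiteDimensional (b.coord i)).comp continuous_snd).smul
    ((continuous_apply (b i)).comp (continuous_induced_dom.comp continuous_fst))

theorem smul_projMk (g : SL3O) (v : {v : h3 // v ≠ 0}) :
    g • projMk v = projMk ⟨g • v.1, (smul_ne_zero_iff_ne g).mpr v.2⟩ := rfl

theorem continuous_smul_projectivization :
    Continuous fun p : SL3O × Projectivization ℝ h3 => p.1 • p.2 := by
  rw [(IsOpenQuotientMap.id.prodMap isOpenQuotientMap_projMk).isQuotientMap.continuous_iff]
  have h : Continuous fun p : SL3O × {v : h3 // v ≠ 0} =>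
      (⟨p.1 • p.2.1, (smul_ne_zero_iff_ne p.1).mpr p.2.2⟩ : {v : h3 // v ≠ 0}) :=
    Continuous.subtype_mk (continuous_SL3O_smul.comp (continuous_fst.prodMk
      (continuous_subtype_val.comp continuous_snd))) _
  exact isOpenQuotientMap_projMk.continuous.comp h

theorem satakeMap_smul (g : SL3O) (x : SymmetricSpace) : satakeMap (g • x) = g • satakeMap x := by
  induction x using QuotientGroup.induction_on with
  | H g' =>
    change projMk ⟨(g * g') • idMat, smul_idMat_ne_zero _⟩ =
      g • projMk ⟨g' • idMat, smul_idMat_ne_zero _⟩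
    simp only [smul_projMk, mul_smul]

/-! ### The sphere of positive semidefinite matrices -/

/-- Positive semidefinite matrices of norm 1 for the trace form. -/
def PsdSphere : Type := {N : h3 // Psd N ∧ inn N N = 1}

instance : TopologicalSpace PsdSphere :=
  inferInstanceAs (TopologicalSpace {N : h3 // Psd N ∧ inn N N = 1})

instance : T2Space PsdSphere := inferInstanceAs (T2Space {N : h3 // Psd N ∧ inn N N = 1})

instance : CompactSpace PsdSphere := by
  refine isCompact_iff_compactSpace.mp
    ((isCompact_inn_le 1).of_isClosed_subset (t := {N : h3 | Psd N ∧ inn N N = 1}) ?_ ?_)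
  · exact isClosed_psd.inter (isClosed_eq (by fun_prop) continuous_const)
  · exact fun N hN => hN.2.le

theorem continuous_psdSphere_val : Continuous fun N : PsdSphere => N.1 := continuous_subtype_val

theorem continuous_posDefOne_val : Continuous fun M : PosDefOne => M.1 := continuous_subtype_val

theorem inn_self_pos {M : h3} (h : M ≠ 0) : 0 < inn M M :=
  (inn_self_nonneg M).lt_of_ne' fun h0 => h (eq_zero_of_inn_self h0)

/-- Normalization of a positive semidefinite matrix. -/
def Psd.normalize {M : h3} (hM : Psd M) (h0 : M ≠ 0) : PsdSphere :=
  ⟨(√(inn M M))⁻¹ • M, hM.smul (inv_nonneg.mpr (Real.sqrt_nonneg _)), by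
    rw [inn_smul_smul, inv_pow, Real.sq_sqrt (inn_self_nonneg M),
      inv_mul_cancel₀ (inn_self_pos h0).ne']⟩

theorem ne_zero_of_det_pos {M : h3} (h : 0 < det M) : M ≠ 0 := by
  rintro rfl
  exact h.ne det_zero.symm

namespace PosDefOne

theorem psd (M : PosDefOne) : Psd M.1 := (isPosDef_iff.mp M.2.1).1

theorem ne_zero (M : PosDefOne) : M.1 ≠ 0 := ne_zero_of_det_pos (M.2.2.symm ▸ one_pos)

/-- The radial projection onto the sphere. -/
def toSphere (M : PosDefOne) : PsdSphere := M.psd.normalize M.ne_zero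

theorem continuous_toSphere : Continuous toSphere := by
  have h : Continuous fun M : PosDefOne => √(inn M.1 M.1) :=
    Real.continuous_sqrt.comp (continuous_inn continuous_posDefOne_val continuous_posDefOne_val)
  exact Continuous.subtype_mk ((h.inv₀ fun M =>
    (Real.sqrt_pos.mpr (inn_self_pos M.ne_zero)).ne').smul continuous_posDefOne_val) _

theorem det_toSphere (M : PosDefOne) : det M.toSphere.1 = (√(inn M.1 M.1))⁻¹ ^ 3 := by
  rw [toSphere, Psd.normalize, det_smul, M.2.2, mul_one]

theorem inv_sqrt_pos (M : PosDefOne) : 0 < (√(inn M.1 M.1))⁻¹ :=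
  inv_pos.mpr (Real.sqrt_pos.mpr (inn_self_pos M.ne_zero))

/-- Where the determinant does not vanish, division by its cube root is a continuous inverse. -/
theorem isEmbedding_toSphere : IsEmbedding toSphere := by
  let D := {N : PsdSphere // det N.1 ≠ 0}
  let ι : PosDefOne → D := fun M => ⟨M.toSphere, by
    rw [det_toSphere]
    exact (pow_pos M.inv_sqrt_pos 3).ne'⟩
  let ρ : D → h3 := fun N => (det N.1.1 ^ (((3 : ℕ) : ℝ)⁻¹))⁻¹ • N.1.1
  have hval : Continuous fun N : D => N.1.1 := continuous_psdSphere_val.comp continuous_subtype_val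
  have hρ : Continuous ρ := by
    have h1 : Continuous fun N : D => det N.1.1 ^ (((3 : ℕ) : ℝ)⁻¹) :=
      (continuous_det.comp hval).rpow_const fun N => Or.inl N.2
    refine (h1.inv₀ fun N => ?_).smul hval
    exact (Real.rpow_pos_of_pos (N.1.2.1.det.lt_of_ne' N.2) _).ne'
  have hι : Continuous ι := continuous_toSphere.subtype_mk _
  have h : IsEmbedding ι := by
    refine IsEmbedding.of_comp hι hρ ?_
    have h1 : ρ ∘ ι = fun M : PosDefOne => M.1 := by
      funext M
      change (det M.toSphere.1 ^ (((3 : ℕ) : ℝ)⁻¹))⁻¹ • M.toSphere.1 = M.1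
      rw [det_toSphere, Real.pow_rpow_inv_natCast M.inv_sqrt_pos.le three_ne_zero]
      change _ • _ • M.1 = M.1
      rw [inv_smul_smul₀ M.inv_sqrt_pos.ne']
    rw [h1]
    exact IsEmbedding.subtypeVal
  exact IsEmbedding.subtypeVal.comp h

theorem normalize_mem_range {M : h3} (hM : Psd M) (hd : 0 < det M) :
    hM.normalize (ne_zero_of_det_pos hd) ∈ Set.range toSphere := by
  set c := (det M ^ (((3 : ℕ) : ℝ)⁻¹))⁻¹ with hc
  have hc0 : 0 < c := inv_pos.mpr (Real.rpow_pos_of_pos hd _)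
  have hdet : det (c • M) = 1 := by
    rw [det_smul, hc, inv_pow, Real.rpow_inv_natCast_pow hd.le three_ne_zero,
      inv_mul_cancel₀ hd.ne']
  refine ⟨⟨c • M, isPosDef_iff.mpr ⟨hM.smul hc0.le, hdet ▸ one_pos⟩, hdet⟩, Subtype.ext ?_⟩
  change (√(inn (c • M) (c • M)))⁻¹ • c • M = (√(inn M M))⁻¹ • M
  rw [inn_smul_smul, Real.sqrt_mul (sq_nonneg c), Real.sqrt_sq hc0.le, smul_smul, mul_inv,
    mul_right_comm, inv_mul_cancel₀ hc0.ne', one_mul]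

theorem denseRange_toSphere : DenseRange toSphere := by
  intro N
  have hε (n : ℕ) : (0 : ℝ) < 1 / ((n : ℝ) + 1) := by positivity
  -- Adding a small multiple of the identity makes the matrix positive definite.
  let u (n : ℕ) : h3 := (1 / ((n : ℝ) + 1)) • idMat + N.1
  have hu (n : ℕ) : Psd (u n) ∧ 0 < det (u n) := N.2.1.add_smul_idMat (hε n)
  have hlim : Filter.Tendsto u Filter.atTop (𝓝 N.1) := by
    have h := (tendsto_one_div_add_atTop_nhds_zero_nat (𝕜 := ℝ)).smul_const idMat
    simpa [u] using h.add_const N.1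
  refine mem_closure_of_tendsto (b := Filter.atTop)
    (f := fun n => (hu n).1.normalize (ne_zero_of_det_pos (hu n).2)) ?_
    (Filter.Eventually.of_forall fun n => normalize_mem_range (hu n).1 (hu n).2)
  refine tendsto_subtype_rng.mpr ?_
  have hinn : Continuous fun M : h3 => inn M M := by fun_prop
  have h1 : Filter.Tendsto (fun n => (√(inn (u n) (u n)))⁻¹ • u n) Filter.atTop
      (𝓝 ((√(inn N.1 N.1))⁻¹ • N.1)) := by
    refine Filter.Tendsto.smul (Filter.Tendsto.inv₀ ?_ ?_) hlim
    · exact ((Real.continuous_sqrt.comp hinn).tendsto N.1).comp hlim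
    · rw [N.2.2]
      simp
  rw [N.2.2, Real.sqrt_one, inv_one, one_smul] at h1
  exact h1

end PosDefOne

/-! ### The two boundary maps -/

theorem PsdSphere.tr_sqr (N : PsdSphere) : tr (sqr N.1) = 1 := by
  rw [OctonionicSatake.tr_sqr, N.2.2]

theorem PsdSphere.sqr_ne_zero (N : PsdSphere) : sqr N.1 ≠ 0 := by
  intro h
  have := N.tr_sqr
  rw [h, map_zero] at this
  exact zero_ne_one this

/-- Both squares have trace 1, so `c = 1`, even when its sign is not known beforehand. -/
theorem PsdSphere.eq_of_sqr_eq_smul {N N' : PsdSphere} {c : ℝ} (h : sqr N'.1 = c • sqr N.1) :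
    N = N' := by
  have h1 := congrArg tr h
  rw [map_smul, N.tr_sqr, N'.tr_sqr, smul_eq_mul, mul_one] at h1
  rw [← h1, one_smul] at h
  exact Subtype.ext (N.2.1.eq_of_sqr_eq N'.2.1 h.symm)

/-- The projective class of the square. -/
def sphereToProj (N : PsdSphere) : Projectivization ℝ h3 := projMk ⟨sqr N.1, N.sqr_ne_zero⟩

theorem continuous_sphereToProj : Continuous sphereToProj :=
  isOpenQuotientMap_projMk.continuous.comp
    ((continuous_sqr.comp continuous_psdSphere_val).subtype_mk _)

theorem injective_sphereToProj : Function.Injective sphereToProj := by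
  intro N N' h
  obtain ⟨a, ha⟩ := (Projectivization.mk_eq_mk_iff' ℝ _ _ N.sqr_ne_zero N'.sqr_ne_zero).mp h
  exact (PsdSphere.eq_of_sqr_eq_smul ha.symm).symm

/-! ### Length functions recover the square of the matrix. -/

variable (𝒪 : OctonionOrder)

theorem norm_sq_latticeMap (M : h3) (u : Fin 3 → 𝒪.toAddSubgroup) : ‖latticeMap 𝒪 M u‖ ^ 2 =
    ‖dA M • (u 0 : Octonion) + oW M * u 1 + star (oY M) * u 2‖ ^ 2 +
    ‖star (oW M) * u 0 + dB M • (u 1 : Octonion) + oX M * u 2‖ ^ 2 +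
    ‖oY M * u 0 + star (oX M) * u 1 + dC M • (u 2 : Octonion)‖ ^ 2 := by
  rw [PiLp.norm_sq_eq_of_L2]
  conv_lhs => rw [← herm_coords M]
  simp [latticeMap, dotProduct, Fin.sum_univ_three, herm]

/-- The lattice vector with value `e i`. -/
def OctonionOrder.unit (i : Fin 8) : 𝒪.toAddSubgroup := ⟨e i, 𝒪.e_mem i⟩

theorem norm_sq_latticeMap_A (M : h3) (i : Fin 8) :
    ‖latticeMap 𝒪 M ![𝒪.unit i, 0, 0]‖ ^ 2 = dA (sqr M) := by
  rw [norm_sq_latticeMap, sqr_eq, dA_herm]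
  simp [OctonionOrder.unit, norm_smul, Octonion.norm_mul, norm_e]
  ring

theorem norm_sq_latticeMap_B (M : h3) (i : Fin 8) :
    ‖latticeMap 𝒪 M ![0, 𝒪.unit i, 0]‖ ^ 2 = dB (sqr M) := by
  rw [norm_sq_latticeMap, sqr_eq, dB_herm]
  simp [OctonionOrder.unit, norm_smul, Octonion.norm_mul, norm_e]
  ring

theorem norm_sq_latticeMap_C (M : h3) (i : Fin 8) :
    ‖latticeMap 𝒪 M ![0, 0, 𝒪.unit i]‖ ^ 2 = dC (sqr M) := by
  rw [norm_sq_latticeMap, sqr_eq, dC_herm]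
  simp [OctonionOrder.unit, norm_smul, Octonion.norm_mul, norm_e]
  ring

/-- One of the two nonzero coordinates is 1, so the cross terms reduce to an inner product with `e
i` by adjunction only. -/
theorem norm_sq_latticeMap_X (M : h3) (i : Fin 8) :
    ‖latticeMap 𝒪 M ![0, 𝒪.unit i, 𝒪.unit 0]‖ ^ 2 =
      dB (sqr M) + dC (sqr M) + 2 * (oX (sqr M)).coord i := by
  rw [norm_sq_latticeMap, sqr_eq, ← inner_e_left]
  simp [OctonionOrder.unit, show e 0 = 1 from rfl, norm_smul, Octonion.norm_mul, norm_e,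
    norm_add_sq_real, inner_add_right, inner_mul_left, inner_smul_left, inner_smul_right]
  ring

theorem norm_sq_latticeMap_Y (M : h3) (i : Fin 8) :
    ‖latticeMap 𝒪 M ![𝒪.unit 0, 0, 𝒪.unit i]‖ ^ 2 =
      dC (sqr M) + dA (sqr M) + 2 * (oY (sqr M)).coord i := by
  have h1 : inner ℝ 1 (star (oY M) * e i) = inner ℝ (e i) (oY M) := by
    rw [real_inner_comm, inner_mul_left, star_star, mul_one]
  have h2 : inner ℝ (star (oW M)) (oX M * e i) = inner ℝ (e i) (star (oX M) * star (oW M)) := by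
    rw [real_inner_comm, inner_mul_left]
  rw [norm_sq_latticeMap, sqr_eq, ← inner_e_left]
  simp [OctonionOrder.unit, show e 0 = 1 from rfl, norm_smul, Octonion.norm_mul, norm_e,
    norm_add_sq_real, inner_add_right, inner_smul_left, inner_smul_right, h1, h2, real_inner_comm (e i) (oY M)]
  ring

theorem norm_sq_latticeMap_W (M : h3) (i : Fin 8) :
    ‖latticeMap 𝒪 M ![𝒪.unit i, 𝒪.unit 0, 0]‖ ^ 2 =
      dA (sqr M) + dB (sqr M) + 2 * (oW (sqr M)).coord i := by
  rw [norm_sq_latticeMap, sqr_eq, ← inner_e_left]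
  simp [OctonionOrder.unit, show e 0 = 1 from rfl, norm_smul, Octonion.norm_mul, norm_e,
    norm_add_sq_real, inner_add_right, inner_mul_left, inner_smul_left, inner_smul_right]
  ring

/-- The length function of a lattice determines the square of the matrix. -/
theorem sqr_eq_smul_of_norm_latticeMap {M N : h3} {d : ℝ}
    (h : ∀ u, ‖latticeMap 𝒪 N u‖ ^ 2 = d * ‖latticeMap 𝒪 M u‖ ^ 2) : sqr N = d • sqr M := by
  have hA := h ![𝒪.unit 0, 0, 0]
  have hB := h ![0, 𝒪.unit 0, 0]
  have hC := h ![0, 0, 𝒪.unit 0]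
  rw [norm_sq_latticeMap_A, norm_sq_latticeMap_A] at hA
  rw [norm_sq_latticeMap_B, norm_sq_latticeMap_B] at hB
  rw [norm_sq_latticeMap_C, norm_sq_latticeMap_C] at hC
  apply h3_ext
  · exact hA
  · exact hB
  · exact hC
  · ext i
    have h1 := h ![0, 𝒪.unit i, 𝒪.unit 0]
    rw [norm_sq_latticeMap_X, norm_sq_latticeMap_X] at h1
    rw [map_smul, coord_smul]
    linarith
  · ext i
    have h1 := h ![𝒪.unit 0, 0, 𝒪.unit i]
    rw [norm_sq_latticeMap_Y, norm_sq_latticeMap_Y] at h1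
    rw [map_smul, coord_smul]
    linarith
  · ext i
    have h1 := h ![𝒪.unit i, 𝒪.unit 0, 0]
    rw [norm_sq_latticeMap_W, norm_sq_latticeMap_W] at h1
    rw [map_smul, coord_smul]
    linarith

theorem continuous_latticeMap (u : Fin 3 → 𝒪.toAddSubgroup) :
    Continuous fun M : h3 => latticeMap 𝒪 M u := by
  refine (PiLp.continuous_toLp 2 _).comp (continuous_pi fun i => ?_)
  simp only [Matrix.mulVec, dotProduct]
  exact continuous_finsetSum _ fun j _ => (continuous_entry i j).mul continuous_const

theorem latticeMap_smul (r : ℝ) (M : h3) (u : Fin 3 → 𝒪.toAddSubgroup) :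
    latticeMap 𝒪 (r • M) u = r • latticeMap 𝒪 M u :=
  congrArg (WithLp.toLp 2) (Matrix.smul_mulVec r M.1 fun i => (u i : Octonion))

theorem PsdSphere.length_ne_zero (N : PsdSphere) : (fun u => ‖latticeMap 𝒪 N.1 u‖₊) ≠ 0 := by
  intro h
  refine N.sqr_ne_zero ?_
  -- Comparing `N` with itself at ratio 0: a vanishing length function would make the square vanish.
  rw [sqr_eq_smul_of_norm_latticeMap 𝒪 (M := N.1) (N := N.1) (d := 0), zero_smul]
  intro u
  have := congrFun h u
  simp only [Pi.zero_apply, nnnorm_eq_zero] at this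
  simp [this]

/-- The projective class of the length function. -/
def sphereToRay (N : PsdSphere) : RayProj (Fin 3 → 𝒪.toAddSubgroup) :=
  Quotient.mk (raySetoid _) ⟨fun u => ‖latticeMap 𝒪 N.1 u‖₊, N.length_ne_zero 𝒪⟩

theorem continuous_sphereToRay : Continuous (sphereToRay 𝒪) :=
  (RayProj.isOpenQuotientMap_mk _).continuous.comp (Continuous.subtype_mk (continuous_pi fun u =>
    ((continuous_latticeMap 𝒪 u).comp continuous_psdSphere_val).nnnorm) _)

theorem injective_sphereToRay : Function.Injective (sphereToRay 𝒪) := by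
  intro N N' h
  obtain ⟨c, -, hc⟩ := Quotient.exact (s := raySetoid _) h
  refine PsdSphere.eq_of_sqr_eq_smul (c := (c : ℝ) ^ 2)
    (sqr_eq_smul_of_norm_latticeMap 𝒪 fun u => ?_)
  have h1 := congrArg ((↑) : ℝ≥0 → ℝ) (congrFun hc u)
  simp only [Pi.smul_apply, smul_eq_mul, NNReal.coe_mul, coe_nnnorm] at h1
  rw [h1, mul_pow]

/-! ### The homeomorphisms -/

theorem lengthMap_latticeClass (M : PosDefOne) :
    lengthMap 𝒪 (latticeClass 𝒪 M) = sphereToRay 𝒪 M.toSphere := by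
  refine Quotient.sound (s := raySetoid _) ⟨⟨_, M.inv_sqrt_pos.le⟩, M.inv_sqrt_pos, funext fun u => ?_⟩
  apply NNReal.eq
  change ‖latticeMap 𝒪 (_ • M.1) u‖ = _ * ‖latticeMap 𝒪 M.1 u‖
  rw [latticeMap_smul, norm_smul, Real.norm_of_nonneg M.inv_sqrt_pos.le]

theorem continuous_lengthMap : Continuous (lengthMap 𝒪) := by
  refine Continuous.quotient_map' (Continuous.subtype_mk (continuous_pi fun u => ?_) _) _
  exact ((continuous_apply u).comp continuous_induced_dom).nnnorm

theorem continuous_latticeClass : Continuous (latticeClass 𝒪) := by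
  refine continuous_quotient_mk'.comp (continuous_induced_rng.mpr (continuous_pi fun u => ?_))
  exact (continuous_latticeMap 𝒪 u).comp continuous_posDefOne_val

/-- The composite with the length map is already an embedding, through the sphere; the quotient
topology needs no direct study. -/
theorem isEmbedding_latticeClass : IsEmbedding (latticeClass 𝒪) := by
  refine IsEmbedding.of_comp (continuous_latticeClass 𝒪) (continuous_lengthMap 𝒪) ?_
  rw [show lengthMap 𝒪 ∘ latticeClass 𝒪 = sphereToRay 𝒪 ∘ PosDefOne.toSphere from
    funext (lengthMap_latticeClass 𝒪)]
  exact ((continuous_sphereToRay 𝒪).isClosedEmbedding (injective_sphereToRay 𝒪)).isEmbedding.comp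
    PosDefOne.isEmbedding_toSphere

theorem surjective_latticeClass : Function.Surjective (latticeClass 𝒪) := by
  intro x
  induction x using Quotient.inductionOn with
  | h f =>
    obtain ⟨f, M, k, hf⟩ := f
    exact ⟨M, Quotient.sound (s := latticeSetoid 𝒪) ⟨k, fun u => (hf u).symm⟩⟩

/-- The space of marked lattices is homeomorphic to that of positive definite matrices. -/
def latticeHomeo : PosDefOne ≃ₜ LatticeSpace 𝒪 :=
  (isEmbedding_latticeClass 𝒪).toHomeomorphOfSurjective (surjective_latticeClass 𝒪)

namespace PosDefOne

/-- The square of a positive definite matrix. -/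
def square (M : PosDefOne) : PosDefOne :=
  ⟨sqr M.1, isPosDef_iff.mpr ⟨psd_sqr _, by rw [det_sqr, M.2.2]; norm_num⟩, by
    rw [det_sqr, M.2.2, one_pow]⟩

theorem continuous_square : Continuous square :=
  (continuous_sqr.comp continuous_posDefOne_val).subtype_mk _

/-- The line spanned by a positive definite matrix. -/
def toProj (M : PosDefOne) : Projectivization ℝ h3 := projMk ⟨M.1, M.ne_zero⟩

theorem continuous_toProj : Continuous toProj :=
  isOpenQuotientMap_projMk.continuous.comp (continuous_posDefOne_val.subtype_mk _)

theorem toProj_square (M : PosDefOne) : M.square.toProj = sphereToProj M.toSphere := by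
  refine (Projectivization.mk_eq_mk_iff' ℝ _ _ _ _).mpr ⟨√(inn M.1 M.1) ^ 2, ?_⟩
  have h (r : ℝ) : sqr (r • M.1) = r ^ 2 • sqr M.1 := by
    apply Subtype.ext
    rw [coe_sqr]
    change (r • M.1.1) * (r • M.1.1) = r ^ 2 • (sqr M.1).1
    rw [coe_sqr, Matrix.smul_mul, Matrix.mul_smul, smul_smul, sq]
  change _ • sqr (_ • M.1) = sqr M.1
  rw [h, smul_smul, ← mul_pow, mul_inv_cancel₀ (inv_pos.mp M.inv_sqrt_pos).ne', one_pow, one_smul]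

/-- Continuity of the square root comes for free: the line of the square is a closed embedding of
the sphere. -/
theorem isEmbedding_square : IsEmbedding square := by
  refine IsEmbedding.of_comp continuous_square continuous_toProj ?_
  rw [show toProj ∘ square = sphereToProj ∘ toSphere from funext toProj_square]
  exact (continuous_sphereToProj.isClosedEmbedding injective_sphereToProj).isEmbedding.comp
    isEmbedding_toSphere

theorem surjective_square : Function.Surjective square := by
  intro P
  obtain ⟨M, hM, h⟩ := P.psd.exists_sqr_eq
  have h1 : det M = 1 := by
    have h2 := det_sqr M
    rw [h, P.2.2] at h2
    exact (sq_eq_sq₀ hM.det zero_le_one).mp (by rw [← h2, one_pow])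
  exact ⟨⟨M, isPosDef_iff.mpr ⟨hM, h1 ▸ one_pos⟩, h1⟩, Subtype.ext h⟩

/-- Squaring, as a homeomorphism. -/
def squareHomeo : PosDefOne ≃ₜ PosDefOne :=
  isEmbedding_square.toHomeomorphOfSurjective surjective_square

theorem squareHomeo_apply (M : PosDefOne) : squareHomeo M = M.square := rfl

end PosDefOne

/-- The square root of `g • I`. -/
def rootHomeo : SymmetricSpace ≃ₜ PosDefOne := orbitHomeo.trans PosDefOne.squareHomeo.symm

theorem rootHomeo_eq_iff (x : SymmetricSpace) (M : PosDefOne) :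
    rootHomeo x = M ↔ (orbitHomeo x).1.1 = M.1.1 * M.1.1 := by
  rw [← coe_sqr, rootHomeo, Homeomorph.trans_apply, Homeomorph.symm_apply_eq,
    PosDefOne.squareHomeo_apply]
  exact ⟨fun h => by rw [h]; rfl, fun h => Subtype.ext (Subtype.ext h)⟩

theorem satakeMap_eq_toProj (x : SymmetricSpace) : satakeMap x = (orbitHomeo x).toProj := by
  induction x using QuotientGroup.induction_on with
  | H g => rfl

/-- The embedding of the symmetric space into the sphere. -/
def symmetricToSphere : SymmetricSpace → PsdSphere := PosDefOne.toSphere ∘ rootHomeo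

theorem isEmbedding_symmetricToSphere : IsEmbedding symmetricToSphere :=
  PosDefOne.isEmbedding_toSphere.comp rootHomeo.isEmbedding

theorem denseRange_symmetricToSphere : DenseRange symmetricToSphere :=
  PosDefOne.denseRange_toSphere.comp rootHomeo.surjective.denseRange PosDefOne.continuous_toSphere

theorem satakeMap_eq : satakeMap = sphereToProj ∘ symmetricToSphere := by
  funext x
  rw [satakeMap_eq_toProj]
  change _ = sphereToProj (rootHomeo x).toSphere
  rw [← PosDefOne.toProj_square, ← PosDefOne.squareHomeo_apply, rootHomeo, Homeomorph.trans_apply,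
    Homeomorph.apply_symm_apply]

theorem lengthMap_comp_eq : lengthMap 𝒪 ∘ rootHomeo.trans (latticeHomeo 𝒪) =
    sphereToRay 𝒪 ∘ symmetricToSphere :=
  funext fun x => lengthMap_latticeClass 𝒪 (rootHomeo x)

theorem isGCompactification_symmetricToSphere : IsGCompactification SL3O symmetricToSphere where
  compactSpace := inferInstance
  t2Space := inferInstance
  isEmbedding := isEmbedding_symmetricToSphere
  denseRange := denseRange_symmetricToSphere
  extends_action := by
    obtain ⟨F, hF⟩ := exists_homeomorph_closure denseRange_symmetricToSphere
      continuous_sphereToProj injective_sphereToProj satakeMap_eq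
    -- The action is built on the Satake closure and pulled back to the sphere.
    have a := (ExtendedAction.ofEquivariant continuous_smul_projectivization
      satakeMap_smul).congr F.symm
    rw [hF, ← Function.comp_assoc, Homeomorph.symm_comp_self, Function.id_comp] at a
    exact ⟨a⟩

end OctonionicSatake

end

open OctonionicSatake in
theorem mainTheorem5 (𝒪 : OctonionOrder) :
    ∃ (h : SymmetricSpace ≃ₜ PosDefOne) (m : SymmetricSpace ≃ₜ LatticeSpace 𝒪),
      (∀ g : SL3O, (h (g : SymmetricSpace)).1 = g • idMat) ∧
      (∀ (x : SymmetricSpace) (M : PosDefOne),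
        m x = latticeClass 𝒪 M ↔ (h x).1.1 = M.1.1 * M.1.1) ∧
      IsGCompactification SL3O (toClosure (lengthMap 𝒪 ∘ m)) ∧
      IsGCompactification SL3O (toClosure satakeMap) ∧
      GIsomorphic SL3O (toClosure (lengthMap 𝒪 ∘ m)) (toClosure satakeMap) := by
  obtain ⟨F, hF⟩ := exists_homeomorph_closure denseRange_symmetricToSphere
    continuous_sphereToProj injective_sphereToProj satakeMap_eq
  obtain ⟨F', hF'⟩ := exists_homeomorph_closure denseRange_symmetricToSphere
    (continuous_sphereToRay 𝒪) (injective_sphereToRay 𝒪) (lengthMap_comp_eq 𝒪)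
  have h1 := isGCompactification_symmetricToSphere.congr F
  have h2 := isGCompactification_symmetricToSphere.congr F'
  rw [← hF] at h1
  rw [← hF'] at h2
  refine ⟨orbitHomeo, rootHomeo.trans (latticeHomeo 𝒪), orbitHomeo_coe, fun x M => ?_, h2, h1, ?_⟩
  · rw [← rootHomeo_eq_iff]
    exact (latticeHomeo 𝒪).injective.eq_iff (a := rootHomeo x) (b := M)
  · refine GIsomorphic.of_homeomorph h2.denseRange (F'.symm.trans F) ?_
    rw [hF, hF']
    funext x
    simp
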